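/- All manifolds are smooth, real, finite-dimensional and without boundary; the base $M$ is Hausdorff and second countable. Let $\mu:P\to M$ be a smooth principal bundle with structure Lie group $G$ and right action $\kappa_g(p)=\kappa_p(g)=pg$; let $T^vP=\operatorname{Ker}T\mu$ be the vertical subbundle. For a manifold $Q$ let $Aut_0TQ$ be the group of smooth automorphisms $A=(A(q):T_qQ\to T_qQ)_{q\in Q}$ of the tangent bundle covering $\mathrm{id}_Q$. The tangent group $TG\cong G\ltimes T_eG$ acts on $TP$ by $\Phi_{(g,X)}(v)=T\kappa_g(p)\big(v+T\kappa_p(e)X\big)$, $v\in T_pP$, $g\in G$, $X\in T_eG$, where $e$ is the unit of $G$. Let - $Aut_{TG}TP\subset Aut_0TP$ be the subgroup of those $A$ with $A(pg)\circ\Phi_{(g,X)}=\Phi_{(g,X)}\circ A(p)$ for all $g,X,p$; - $Aut_NTP\subset Aut_{TG}TP$ be the subgroup of those $A$ with $A(p)=\mathrm{id}_p+B(p)$, $B(p):T_pP\to T^v_pP$, for all $p$; - $End_NTP$ be the vector space of smooth families $B(p)\in End(T_pP)$ with $B(pg)\circ T\kappa_g(p)=T\kappa_g(p)\circ B(p)$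 and $\operatorname{Im}B(p)\subset T^v_pP\subset\operatorname{Ker}B(p)$ for all $p,g$. A connection $\alpha$ is a smooth $T_eG$-valued one-form on $P$ with $\alpha_p\circ T\kappa_p(e)=\mathrm{id}$ and $\alpha_{pg}\circ T\kappa_g(p)=Ad_{g^{-1}}\circ\alpha_p$. Let $\Gamma_\alpha(p):T_{\mu(p)}M\to\operatorname{Ker}\alpha_p$ be the inverse of $T\mu(p)|_{\operatorname{Ker}\alpha_p}$ and $\Pi^v_\alpha(p)=T\kappa_p(e)\circ\alpha_p$ the projection of $T_pP$ onto $T^v_pP$ along $\operatorname{Ker}\alpha_p$. **Proposition.** The map $B\mapsto\mathrm{id}+B$ is an isomorphism of the additive group $End_NTP$ onto $Aut_NTP$ (so $Aut_NTP$ is abelian). Moreover: (i) There is a unique map $\lambda:Aut_{TG}TP\to Aut_0TM$ with $\lambda(A)(\mu(p))\,T\mu(p)v=T\mu(p)A(p)v$ for all $A$, $p\in P$, $v\in T_pP$; it is a group homomorphism, and with the inclusion $\iota$ the sequence $$\{\mathrm{id}\}\to Aut_NTP\xrightarrow{\ \iota\ }Aut_{TG}TP\xrightarrow{\ \lambda\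 }Aut_0TM\to\{\mathrm{id}\}$$ is exact. (ii) For every connection $\alpha$ the formula $$\sigma_\alpha(\tilde A)(p)=\Pi^v_\alpha(p)+\Gamma_\alpha(p)\circ\tilde A(\mu(p))\circ T\mu(p)$$ defines an injective group homomorphism $\sigma_\alpha:Aut_0TM\to Aut_{TG}TP$, and $\beta_\alpha(A)=A\,\sigma_\alpha(\lambda(A))^{-1}$ defines a surjection $\beta_\alpha:Aut_{TG}TP\to Aut_NTP$, such that $\beta_\alpha^{-1}(\mathrm{id})=\operatorname{Im}\sigma_\alpha$, $\lambda\circ\sigma_\alpha=\mathrm{id}$, $\beta_\alpha\circ\iota=\mathrm{id}$, and $$\beta_\alpha(A_1A_2)=\beta_\alpha(A_1)\,\sigma_\alpha(\lambda(A_1))\,\beta_\alpha(A_2)\,\sigma_\alpha(\lambda(A_1))^{-1}.$$ (iii) For every connection $\alpha$ the decomposition $A=(\mathrm{id}+B)\,\sigma_\alpha(\tilde A)$ defines an isomorphism of $Aut_{TG}TP$ with a semidirect product group $Aut_0TM\ltimes_\alpha End_NTP$, whose product is $$(\tilde A_1,B_1)\cdot(\tilde A_2,B_2)=\big(\tilde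 A_1\tilde A_2,\;B_1+B_2\circ\Gamma_\alpha\circ\tilde A_1^{-1}\circ T\mu\big),$$ that is, the second component at $p$ is $B_1(p)+B_2(p)\circ\Gamma_\alpha(p)\circ\tilde A_1(\mu(p))^{-1}\circ T\mu(p)$. -/

import Mathlib

open Set Bundle
open scoped Manifold ContDiff

section Aut
variable {E H : Type*} [NormedAddCommGroup E] [NormedSpace ℝ E] [TopologicalSpace H]
  {I : ModelWithCorners ℝ E H} {X : Type*} [TopologicalSpace X] [ChartedSpace H X]

/-- A family of endomorphisms `B x : T_x X → T_x X` depends smoothly on `x`: the fibre-preserving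
map `TX → TX` that it defines is smooth. -/
def IsSmoothTangentEndo [IsManifold I ∞ X] (B : ∀ x : X, TangentSpace I x →L[ℝ] TangentSpace I x) : Prop :=
  ContMDiff I.tangent I.tangent ∞
    (fun v : TangentBundle I X => (⟨v.proj, B v.proj v.snd⟩ : TangentBundle I X))

variable [IsManifold I ∞ X]

theorem IsSmoothTangentEndo.iff_coord (B : ∀ x : X, TangentSpace I x →L[ℝ] TangentSpace I x) :
    IsSmoothTangentEndo B ↔ ∀ v : TangentBundle I X,
      ContMDiffAt I.tangent 𝓘(ℝ, E) ∞ (fun w : TangentBundle I X =>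
        (trivializationAt E (TangentSpace I) v.proj ⟨w.proj, B w.proj w.snd⟩).2) v := by
  refine forall_congr' fun v => ?_
  rw [contMDiffAt_totalSpace]
  exact and_iff_right (contMDiffAt_proj (TangentSpace I))

theorem tangent_coord_linear (x : X) {y : X} (hy : y ∈ (trivializationAt E (TangentSpace I) x).baseSet)
   (v : TangentSpace I y) :  (trivializationAt E (TangentSpace I) x ⟨y, v⟩).2
     = (trivializationAt E (TangentSpace I) x).continuousLinearEquivAt ℝ y hy v := rfl

theorem tangent_eventually_mem_baseSet (v : TangentBundle I X) :
    ∀ᶠ w : TangentBundle I X in nhds v,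
      w.proj ∈ (trivializationAt E (TangentSpace I) v.proj).baseSet :=
  (FiberBundle.continuous_proj E (TangentSpace I)).continuousAt.eventually
    ((trivializationAt E (TangentSpace I) v.proj).open_baseSet.mem_nhds
      (mem_baseSet_trivializationAt E (TangentSpace I) v.proj))

theorem IsSmoothTangentEndo.add {B C : ∀ x : X, TangentSpace I x →L[ℝ] TangentSpace I x}
    (hB : IsSmoothTangentEndo B) (hC : IsSmoothTangentEndo C) : IsSmoothTangentEndo (fun x => B x + C x) := by
  rw [IsSmoothTangentEndo.iff_coord] at *
  intro v
  refine ((hB v).add (hC v)).congr_of_eventuallyEq ?_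
  have hn : ∀ᶠ w : TangentBundle I X in nhds v, w.proj ∈ (trivializationAt E (TangentSpace I) v.proj).baseSet :=
    (FiberBundle.continuous_proj E (TangentSpace I)).continuousAt.eventually
      ((trivializationAt E (TangentSpace I) v.proj).open_baseSet.mem_nhds (mem_baseSet_trivializationAt E (TangentSpace I) v.proj))
  filter_upwards [hn] with w hw
  simp only [Pi.add_apply, tangent_coord_linear _ hw, ← map_add]
  rfl

theorem IsSmoothTangentEndo.inv [FiniteDimensional ℝ E] {A : ∀ x : X, TangentSpace I x ≃L[ℝ] TangentSpace I x}
    (hA : IsSmoothTangentEndo (fun x => (A x : TangentSpace I x →L[ℝ] TangentSpace I x))) :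
    IsSmoothTangentEndo (fun x => ((A x).symm : TangentSpace I x →L[ℝ] TangentSpace I x)) := by
  rw [IsSmoothTangentEndo.iff_coord]
  intro v
  set x := v.proj with hx
  set e := trivializationAt E (TangentSpace I) x with he
  have hxe : x ∈ e.baseSet := mem_baseSet_trivializationAt E (TangentSpace I) x
  -- the matrix of `A` in the trivialization at `x`
  let a : X → E →L[ℝ] E := fun y => (e.continuousLinearMapAt ℝ y).comp
    ((A y : TangentSpace I y →L[ℝ] TangentSpace I y).comp (e.symmL ℝ y))
  have hvec : ∀ u : E, ContMDiffAt I 𝓘(ℝ, E) ∞ (fun y => a y u) x := by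
    intro u
    have h1 : ContMDiffAt I I.tangent ∞ (fun y : X => (⟨y, e.symm y u⟩ : TangentBundle I X)) x := by
      rw [contMDiffAt_section]
      refine (contMDiffAt_const (c := u)).congr_of_eventuallyEq ?_
      filter_upwards [e.open_baseSet.mem_nhds hxe] with y hy
      have := e.apply_mk_symm hy u
      rw [← he, this]
    have h2 := ((hA _).comp x h1)
    rw [contMDiffAt_totalSpace] at h2
    refine h2.2.congr_of_eventuallyEq ?_
    filter_upwards [e.open_baseSet.mem_nhds hxe] with y hy
    simp only [a, ContinuousLinearMap.comp_apply, Bundle.Trivialization.continuousLinearMapAt_apply,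
      Bundle.Trivialization.coe_linearMapAt_of_mem _ hy, Bundle.Trivialization.symmL_apply e hy]
    rfl
  have hclm : ContMDiffAt I 𝓘(ℝ, E →L[ℝ] E) ∞ a x := by
    let b := Module.finBasis ℝ E
    have h : a = fun y => ∑ i, ContinuousLinearMap.smulRightL ℝ E E
        (LinearMap.toContinuousLinearMap (b.coord i)) (a y (b i)) := by
      funext y
      ext u
      conv_lhs => rw [← b.sum_repr u]
      simp only [map_sum, map_smul]
      simp
    rw [h]
    refine ContMDiffAt.sum fun i _ => ?_
    exact (ContinuousLinearMap.smulRightL ℝ E E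
        (LinearMap.toContinuousLinearMap (b.coord i))).contMDiff.contMDiffAt.comp x (hvec (b i))
  have hai : ∀ y (hy : y ∈ e.baseSet), a y =
      (((e.continuousLinearEquivAt ℝ y hy).symm.trans ((A y).trans
        (e.continuousLinearEquivAt ℝ y hy)) : E ≃L[ℝ] E) : E →L[ℝ] E) := by
    intro y hy
    ext u
    simp only [a, ContinuousLinearMap.comp_apply, Bundle.Trivialization.continuousLinearMapAt_apply,
      Bundle.Trivialization.coe_linearMapAt_of_mem _ hy]
    rw [← Bundle.Trivialization.symm_continuousLinearEquivAt_eq e hy]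
    rfl
  have hinv : ContMDiffAt I 𝓘(ℝ, E →L[ℝ] E) ∞ (fun y => ContinuousLinearMap.inverse (a y)) x := by
    refine ContMDiffAt.comp (g := ContinuousLinearMap.inverse) x ?_ hclm
    rw [hai x hxe]
    exact (contDiffAt_map_inverse _).contMDiffAt
  have hinv' : ContMDiffAt I.tangent 𝓘(ℝ, E →L[ℝ] E) ∞
      (fun w : TangentBundle I X => ContinuousLinearMap.inverse (a w.proj)) v :=
    ContMDiffAt.comp (g := fun y => ContinuousLinearMap.inverse (a y)) v hinv
      (contMDiffAt_proj (TangentSpace I))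
  have hv := ((contMDiffAt_totalSpace (IB := I) (n := ∞) (f := fun w : TangentBundle I X => w) (x₀ := v)).1 contMDiffAt_id).2
  refine (hinv'.clm_apply hv).congr_of_eventuallyEq ?_
  have hn : ∀ᶠ w : TangentBundle I X in nhds v, w.proj ∈ e.baseSet :=
    (FiberBundle.continuous_proj E (TangentSpace I)).continuousAt.eventually
      (e.open_baseSet.mem_nhds hxe)
  filter_upwards [hn] with w hw
  rw [hai _ hw, ContinuousLinearMap.inverse_equiv, tangent_coord_linear _ hw]
  change _ = e.continuousLinearEquivAt ℝ w.proj hw ((A w.proj).symm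
    ((e.continuousLinearEquivAt ℝ w.proj hw).symm (e.continuousLinearEquivAt ℝ w.proj hw w.snd)))
  rw [ContinuousLinearEquiv.symm_apply_apply]
  rfl
theorem IsSmoothTangentEndo.zero : IsSmoothTangentEndo (fun x : X => (0 : TangentSpace I x →L[ℝ] TangentSpace I x)) := by
  rw [IsSmoothTangentEndo.iff_coord]
  intro v
  refine (contMDiffAt_const (c := (0 : E))).congr_of_eventuallyEq ?_
  filter_upwards [tangent_eventually_mem_baseSet v] with w hw
  rw [tangent_coord_linear _ hw]
  exact map_zero _

theorem IsSmoothTangentEndo.const_smul (c : ℝ) {B : ∀ x : X, TangentSpace I x →L[ℝ] TangentSpace I x}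
    (hB : IsSmoothTangentEndo B) : IsSmoothTangentEndo (fun x => c • B x) := by
  rw [IsSmoothTangentEndo.iff_coord] at *
  intro v
  refine ((contMDiffAt_const (I := I.tangent) (I' := 𝓘(ℝ, ℝ)) (x := v) (n := ∞) (c := c)).smul (hB v)).congr_of_eventuallyEq ?_
  filter_upwards [tangent_eventually_mem_baseSet v] with w hw
  simp only [Pi.smul_apply', tangent_coord_linear _ hw]
  exact map_smul _ c _

variable [FiniteDimensional ℝ E]

variable (I X) in
/-- The group `Aut₀ TX` of smooth automorphisms of the tangent bundle `TX` covering `id_X`: families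
of linear isomorphisms `A x : T_x X → T_x X` depending smoothly on `x`, with pointwise
composition `(A * B) x = A x ∘ B x`. -/
def TangentAut : Subgroup (∀ x : X, TangentSpace I x ≃L[ℝ] TangentSpace I x) where
  carrier := {A | IsSmoothTangentEndo (fun x => (A x : TangentSpace I x →L[ℝ] TangentSpace I x))}
  one_mem' := contMDiff_id
  mul_mem' {A _} hA hB := ContMDiff.comp (I' := I.tangent)
    (g := fun v : TangentBundle I X => (⟨v.proj, A v.proj v.snd⟩ : TangentBundle I X)) hA hB
  inv_mem' hA := hA.inv

end Aut

section PB
variable {EM HM EG HG EP HP : Type*}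
  [NormedAddCommGroup EM] [NormedSpace ℝ EM] [TopologicalSpace HM]
  [NormedAddCommGroup EG] [NormedSpace ℝ EG] [TopologicalSpace HG]
  [NormedAddCommGroup EP] [NormedSpace ℝ EP] [TopologicalSpace HP]

/-- A smooth principal `G`-bundle `proj : P → M` with right action `act p g = p g`, locally trivial
through `G`-equivariant diffeomorphisms `proj ⁻¹' U ≃ U × G` over the open sets `U` of a cover. -/
structure PrincipalBundle (IM : ModelWithCorners ℝ EM HM) (IG : ModelWithCorners ℝ EG HG)
    (IP : ModelWithCorners ℝ EP HP) (M G P : Type*)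
    [TopologicalSpace M] [ChartedSpace HM M] [TopologicalSpace G] [ChartedSpace HG G] [Group G]
    [TopologicalSpace P] [ChartedSpace HP P] where
  proj : P → M
  act : P → G → P
  contMDiff_proj : ContMDiff IP IM ∞ proj
  contMDiff_act : ContMDiff (IP.prod IG) IP ∞ (fun x : P × G => act x.1 x.2)
  act_one : ∀ p, act p 1 = p
  act_mul : ∀ p g h, act p (g * h) = act (act p g) h
  proj_act : ∀ p g, proj (act p g) = proj p
  exists_trivialization : ∀ m : M, ∃ (U : Set M) (e : OpenPartialHomeomorph P (M × G)),
    IsOpen U ∧ m ∈ U ∧ e.source = proj ⁻¹' U ∧ e.target = U ×ˢ (univ : Set G) ∧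
    ContMDiffOn IP (IM.prod IG) ∞ e e.source ∧
    ContMDiffOn (IM.prod IG) IP ∞ e.symm e.target ∧
    (∀ p ∈ e.source, (e p).1 = proj p) ∧
    (∀ p ∈ e.source, ∀ g, e (act p g) = ((e p).1, (e p).2 * g))

namespace PrincipalBundle
variable {IM : ModelWithCorners ℝ EM HM} {IG : ModelWithCorners ℝ EG HG}
  {IP : ModelWithCorners ℝ EP HP} {M G P : Type*}
  [TopologicalSpace M] [ChartedSpace HM M] [TopologicalSpace G] [ChartedSpace HG G] [Group G]
  [TopologicalSpace P] [ChartedSpace HP P]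
  (𝔓 : PrincipalBundle IM IG IP M G P)

/-- The differential `T_p μ : T_p P → T_{μ(p)} M` of the projection. -/
noncomputable def Tproj (p : P) : TangentSpace IP p →L[ℝ] TangentSpace IM (𝔓.proj p) :=
  mfderiv IP IM 𝔓.proj p

/-- The differential `T κ_g(p) : T_p P → T_{pg} P` of the right translation `κ_g`. -/
noncomputable def Tact (g : G) (p : P) : TangentSpace IP p →L[ℝ] TangentSpace IP (𝔓.act p g) :=
  mfderiv IP IP (fun q => 𝔓.act q g) p

/-- The differential `T κ_p(e) : T_e G → T_p P` of the orbit map `κ_p : g ↦ p g` at the unit. (It takes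
values in the tangent space at `p e = p`.) -/
noncomputable def fund (p : P) : TangentSpace IG (1 : G) →L[ℝ] TangentSpace IP p :=
  mfderiv IG IP (𝔓.act p) 1

/-- The vertical subspace `T^v_p P = Ker T_p μ`. -/
noncomputable def vert (p : P) : Submodule ℝ (TangentSpace IP p) := (𝔓.Tproj p).ker

theorem mdiff_proj (p : P) : MDifferentiableAt IP IM 𝔓.proj p :=
  (𝔓.contMDiff_proj p).mdifferentiableAt (by simp)

theorem mdiff_act_snd  [IsManifold IP ∞ P] [IsManifold IG ∞ G] (p : P) (g : G) : MDifferentiableAt IG IP (𝔓.act p) g :=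
  ((𝔓.contMDiff_act.comp (contMDiff_const.prodMk contMDiff_id)) g).mdifferentiableAt (by simp)

theorem Tproj_fund [IsManifold IP ∞ P] [IsManifold IG ∞ G] (p : P) (X : TangentSpace IG (1 : G)) : 𝔓.Tproj p (𝔓.fund p X) = 0 := by
  have hc : 𝔓.proj ∘ 𝔓.act p = fun _ => 𝔓.proj p := funext fun g => 𝔓.proj_act p g
  have h1 := mfderiv_comp (I'' := IM) (1 : G) (𝔓.mdiff_proj (𝔓.act p 1)) (𝔓.mdiff_act_snd p 1)
  rw [hc, mfderiv_const] at h1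
  have key : ∀ p' : P, p' = p → ∀ w : EP,
    (mfderiv IP IM 𝔓.proj p' : EP →L[ℝ] EM) w = (mfderiv IP IM 𝔓.proj p : EP →L[ℝ] EM) w := by
    rintro _ rfl _; rfl
  have h2 := DFunLike.congr_fun h1 X
  exact (key _ (𝔓.act_one p) _).symm.trans h2.symm

theorem exists_section [IsManifold IP ∞ P] [IsManifold IM ∞ M] [LieGroup IG ∞ G]  (p : P) : ∃ (s : M → P) (h : P → G), MDifferentiableAt IM IP s (𝔓.proj p) ∧
    MDifferentiableAt IP IG h p ∧ s (𝔓.proj p) = p ∧ h p = 1 ∧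
    (∀ᶠ m in nhds (𝔓.proj p), 𝔓.proj (s m) = m) ∧
    ∀ᶠ q in nhds p, 𝔓.act (s (𝔓.proj q)) (h q) = q := by
  obtain ⟨U, e, hU, hpU, hs, ht, he, hes, he1, hea⟩ := 𝔓.exists_trivialization (𝔓.proj p)
  have hp : p ∈ e.source := by rw [hs]; exact hpU
  have hms : ∀ m ∈ U, ∀ g : G, e.symm (m, g) ∈ e.source := fun m hm g =>
    e.map_target (by rw [ht]; exact ⟨hm, mem_univ _⟩)
  have hr : ∀ m ∈ U, ∀ g : G, e (e.symm (m, g)) = (m, g) := fun m hm g =>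
    e.right_inv (by rw [ht]; exact ⟨hm, mem_univ _⟩)
  have hmdt : ∀ x ∈ e.target, MDifferentiableAt (IM.prod IG) IP e.symm x := fun x hx =>
    ((hes x hx).contMDiffAt (e.open_target.mem_nhds hx)).mdifferentiableAt (by simp)
  refine ⟨fun m => e.symm (m, (e p).2), fun q => (e p).2⁻¹ * (e q).2, ?_, ?_, ?_, by simp, ?_, ?_⟩
  · exact MDifferentiableAt.comp (g := e.symm) (f := fun m => (m, (e p).2)) _
      (hmdt _ (by rw [ht]; exact ⟨hpU, mem_univ _⟩)) (mdifferentiableAt_id.prodMk mdifferentiableAt_const)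
  · have h1 : MDifferentiableAt IP (IM.prod IG) e p :=
      ((he p hp).contMDiffAt (e.open_source.mem_nhds hp)).mdifferentiableAt (by simp)
    have h2 : MDifferentiableAt IP IG (fun q => (e q).2) p := h1.snd
    exact MDifferentiableAt.comp (g := fun g => (e p).2⁻¹ * g) p
      ((contMDiff_mul_left (I := IG) (n := ∞) _).mdifferentiableAt (by simp)) h2
  · have : (𝔓.proj p, (e p).2) = e p := by rw [← he1 p hp]
    simp only [this]
    exact e.left_inv hp
  · filter_upwards [hU.mem_nhds hpU] with m hm
    rw [← he1 _ (hms m hm _), hr m hm]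
  · filter_upwards [e.open_source.mem_nhds hp] with q hq
    have hqU : 𝔓.proj q ∈ U := by rw [hs] at hq; exact hq
    have hq' := hms _ hqU (e p).2
    have hq'' : 𝔓.act (e.symm (𝔓.proj q, (e p).2)) ((e p).2⁻¹ * (e q).2) ∈ e.source := by
      rw [hs, mem_preimage, 𝔓.proj_act, ← mem_preimage, ← hs]; exact hq'
    refine e.injOn hq'' hq ?_
    rw [hea _ hq', hr _ hqU, ← he1 q hq]
    simp

theorem Tproj_surjective [IsManifold IP ∞ P] [IsManifold IM ∞ M] [LieGroup IG ∞ G] (p : P) :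
    Function.Surjective (𝔓.Tproj p) := by
  obtain ⟨s, h, hs, -, hsp, -, hps, -⟩ := 𝔓.exists_section p
  intro w
  have h1 := mfderiv_comp (I'' := IM) (𝔓.proj p) (𝔓.mdiff_proj (s (𝔓.proj p))) hs
  have hid : 𝔓.proj ∘ s =ᶠ[nhds (𝔓.proj p)] id := hps
  rw [hid.mfderiv_eq, mfderiv_id] at h1
  have key : ∀ p' : P, p' = p → ∀ w : EP,
    (mfderiv IP IM 𝔓.proj p' : EP →L[ℝ] EM) w = (mfderiv IP IM 𝔓.proj p : EP →L[ℝ] EM) w := by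
    rintro _ rfl _; rfl
  exact ⟨(mfderiv IM IP s (𝔓.proj p) w : EP), (key _ hsp _).symm.trans (DFunLike.congr_fun h1 w).symm⟩

theorem vert_le_range_fund [IsManifold IP ∞ P] [IsManifold IM ∞ M] [LieGroup IG ∞ G] (p : P)
    (v : TangentSpace IP p) (hv : 𝔓.Tproj p v = 0) : ∃ X, 𝔓.fund p X = v := by
  obtain ⟨s, h, hs, hh, hsp, hh1, -, hq⟩ := 𝔓.exists_section p
  let a : P × G → P := fun x => 𝔓.act x.1 x.2
  have ha : ∀ x, MDifferentiableAt (IP.prod IG) IP a x := fun x =>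
    (𝔓.contMDiff_act x).mdifferentiableAt (by simp)
  have hsm : MDifferentiableAt IP IP (s ∘ 𝔓.proj) p := hs.comp p (𝔓.mdiff_proj p)
  have h1 := mfderiv_comp (I'' := IP) p (ha ((s ∘ 𝔓.proj) p, h p)) (hsm.prodMk hh)
  have hid : a ∘ (fun q => ((s ∘ 𝔓.proj) q, h q)) =ᶠ[nhds p] id := hq
  rw [hid.mfderiv_eq, mfderiv_id, mfderiv_prodMk hsm hh, mfderiv_comp (I' := IM) p hs (𝔓.mdiff_proj p)] at h1
  have h2 := mfderiv_comp (I'' := IP) (h p) (ha ((s ∘ 𝔓.proj) p, h p))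
    ((mdifferentiableAt_const (c := (s ∘ 𝔓.proj) p)).prodMk (mdifferentiableAt_id (I := IG)))
  rw [show mfderiv IG (IP.prod IG) (fun g : G => ((s ∘ 𝔓.proj) p, g)) (h p) = _ from
    mfderiv_prodMk mdifferentiableAt_const mdifferentiableAt_id, mfderiv_const,
    show mfderiv IG IG (fun g : G => g) (h p) = _ from mfderiv_id] at h2
  have key : ∀ p' : P, p' = p → ∀ g : G, g = 1 → ∀ w : EG,
    (mfderiv IG IP (𝔓.act p') g : EG →L[ℝ] EP) w = (mfderiv IG IP (𝔓.act p) 1 : EG →L[ℝ] EP) w := by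
    rintro _ rfl _ rfl _; rfl
  let X : EG := mfderiv IP IG h p v
  have h3 : v = (mfderiv (IP.prod IG) IP a ((s ∘ 𝔓.proj) p, h p) : EP × EG →L[ℝ] EP)
      ((mfderiv IM IP s (𝔓.proj p) : EM →L[ℝ] EP) (𝔓.Tproj p v : EM), X) := DFunLike.congr_fun h1 v
  have hv' : (𝔓.Tproj p v : EM) = (0 : EM) := hv
  have h4 := DFunLike.congr_fun h2 X
  have h5 : (mfderiv IG IP (𝔓.act (s (𝔓.proj p))) (h p) : EG →L[ℝ] EP) X =
    (mfderiv (IP.prod IG) IP a ((s ∘ 𝔓.proj) p, h p) : EP × EG →L[ℝ] EP) ((0 : EP), X) := h4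
  refine ⟨X, (key _ hsp _ hh1 X).symm.trans (h5.trans (h3.trans ?_).symm)⟩
  have h6 : (mfderiv IM IP s (𝔓.proj p) : EM →L[ℝ] EP) (𝔓.Tproj p v : EM) = (0 : EP) := by
    rw [hv']
    exact map_zero (mfderiv IM IP s (𝔓.proj p) : EM →L[ℝ] EP)
  exact congrArg (fun y : EP => (mfderiv (IP.prod IG) IP a ((s ∘ 𝔓.proj) p, h p) :
    EP × EG →L[ℝ] EP) (y, X)) h6

/-- The action `Φ_{(g,X)}(v) = T κ_g(p) (v + T κ_p(e) X)` on `TP` of the tangent group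
`TG ≅ G ⋉ T_e G`. -/
noncomputable def tangentAct (g : G) (X : TangentSpace IG (1 : G)) (p : P) (v : TangentSpace IP p) :
    TangentSpace IP (𝔓.act p g) :=
  𝔓.Tact g p (v + 𝔓.fund p X)

variable (IG G) in
/-- The adjoint representation: `Ad_g` is the differential at `e` of `h ↦ g h g⁻¹`. -/
noncomputable def Ad (g : G) : TangentSpace IG (1 : G) →L[ℝ] TangentSpace IG (1 : G) :=
  mfderiv IG IG (fun h => g * h * g⁻¹) 1

variable [IsManifold IP ∞ P]

/-- A connection form: a smooth `T_e G`-valued one-form `α` on `P` with `α_p ∘ T κ_p(e) = id` and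
`α_{pg} ∘ T κ_g(p) = Ad_{g⁻¹} ∘ α_p`. Smoothness is that of the function `v ↦ α(v)` on `TP`. -/
structure Connection where
  form : ∀ p : P, TangentSpace IP p →L[ℝ] TangentSpace IG (1 : G)
  smooth : ContMDiff (M' := EG) IP.tangent 𝓘(ℝ, EG) ∞
    (fun v : TangentBundle IP P => form v.proj v.snd)
  form_fund : ∀ p X, form p (𝔓.fund p X) = X
  form_Tact : ∀ p g v, form (𝔓.act p g) (𝔓.Tact g p v) = Ad IG G g⁻¹ (form p v)

namespace Connection
variable {𝔓} [IsManifold IM ∞ M] [LieGroup IG ∞ G] (α : 𝔓.Connection)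

/-- The horizontal subspace `Ker α_p`. -/
noncomputable def hor (p : P) : Submodule ℝ (TangentSpace IP p) := (α.form p).ker

/-- The projection `Π^v_α(p) = T κ_p(e) ∘ α_p` of `T_p P` onto the vertical subspace along the
horizontal one. -/
noncomputable def verticalProj (p : P) : TangentSpace IP p →L[ℝ] TangentSpace IP p :=
  (𝔓.fund p).comp (α.form p)

theorem bijective_Tproj_hor (p : P) :
    Function.Bijective ((𝔓.Tproj p : TangentSpace IP p →ₗ[ℝ] TangentSpace IM (𝔓.proj p)).domRestrict
      (α.hor p)) := by
  constructor
  · rw [injective_iff_map_eq_zero]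
    rintro ⟨v, hv⟩ h
    obtain ⟨X, rfl⟩ := 𝔓.vert_le_range_fund p v h
    have hX : X = 0 := (α.form_fund p X).symm.trans hv
    subst hX
    ext
    exact map_zero _
  · intro w
    obtain ⟨v, rfl⟩ := 𝔓.Tproj_surjective p w
    have h1 : α.form p (v - 𝔓.fund p (α.form p v)) = 0 := by
      rw [map_sub, α.form_fund, sub_self]
    have h2 : 𝔓.Tproj p (v - 𝔓.fund p (α.form p v)) = 𝔓.Tproj p v := by
      rw [map_sub, 𝔓.Tproj_fund, sub_zero]
    exact ⟨⟨v - 𝔓.fund p (α.form p v), h1⟩, h2⟩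

/-- The horizontal lift `Γ_α(p) : T_{μ(p)} M → T_p P`, the inverse of the isomorphism
`T_p μ : Ker α_p → T_{μ(p)} M`. -/
noncomputable def lift (p : P) : TangentSpace IM (𝔓.proj p) →ₗ[ℝ] TangentSpace IP p :=
  (α.hor p).subtype ∘ₗ (LinearEquiv.ofBijective _ (α.bijective_Tproj_hor p)).symm.toLinearMap
end Connection

variable [FiniteDimensional ℝ EP]

/-- The group `Aut_{TG} TP` of those `A ∈ Aut₀ TP` which commute with the action of `TG` on `TP`. -/
def AutTG : Subgroup (∀ p : P, TangentSpace IP p ≃L[ℝ] TangentSpace IP p) where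
  carrier := {A | A ∈ TangentAut IP P ∧ ∀ g X p v,
    A (𝔓.act p g) (𝔓.tangentAct g X p v) = 𝔓.tangentAct g X p (A p v)}
  one_mem' := ⟨one_mem _, fun _ _ _ _ => rfl⟩
  mul_mem' {A B} hA hB := ⟨mul_mem hA.1 hB.1, fun g X p v => by
    change A _ (B _ _) = _
    rw [hB.2, hA.2]
    rfl⟩
  inv_mem' {A} hA := ⟨inv_mem hA.1, fun g X p v => by
    have h := hA.2 g X p ((A p).symm v)
    rw [ContinuousLinearEquiv.apply_symm_apply] at h
    change (A _).symm _ = _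
    rw [ContinuousLinearEquiv.symm_apply_eq]
    exact h.symm⟩

/-- The subgroup `Aut_N TP` of those `A ∈ Aut_{TG} TP` with `A(p) = id + B(p)`,
`B(p) : T_p P → T^v_p P`. -/
def AutN : Subgroup 𝔓.AutTG where
  carrier := {A | ∀ p v, A.1 p v - v ∈ 𝔓.vert p}
  one_mem' := fun p v => by
    change v - v ∈ _
    simp
  mul_mem' {A B} hA hB := fun p v => by
    change A.1 p (B.1 p v) - v ∈ _
    have := add_mem (hA p (B.1 p v)) (hB p v)
    simpa using this
  inv_mem' {A} hA := fun p v => by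
    change (A.1 p).symm v - v ∈ _
    have := neg_mem (hA p ((A.1 p).symm v))
    rw [ContinuousLinearEquiv.apply_symm_apply] at this
    simpa using this

/-- The vector space `End_N TP` of smooth endomorphisms `B` of `TP` covering `id_P` which commute with
the action of `G` and satisfy `Im B(p) ⊂ T^v_p P ⊂ Ker B(p)`. -/
def EndN : Submodule ℝ (∀ p : P, TangentSpace IP p →L[ℝ] TangentSpace IP p) where
  carrier := {B | IsSmoothTangentEndo B ∧
    (∀ p g v, B (𝔓.act p g) (𝔓.Tact g p v) = 𝔓.Tact g p (B p v)) ∧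
    ∀ p, (B p).range ≤ 𝔓.vert p ∧ 𝔓.vert p ≤ (B p).ker}
  zero_mem' := by
    refine ⟨IsSmoothTangentEndo.zero, fun p g v => ?_, fun p => ⟨?_, ?_⟩⟩
    · exact (map_zero _).symm
    · rintro _ ⟨v, rfl⟩; exact zero_mem _
    · intro v _; rfl
  add_mem' {B C} hB hC := by
    refine ⟨hB.1.add hC.1, fun p g v => ?_, fun p => ⟨?_, ?_⟩⟩
    · change B _ _ + C _ _ = 𝔓.Tact g p (B p v + C p v)
      rw [hB.2.1, hC.2.1, map_add]
    · rintro _ ⟨v, rfl⟩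
      exact add_mem ((hB.2.2 p).1 ⟨v, rfl⟩) ((hC.2.2 p).1 ⟨v, rfl⟩)
    · intro v hv
      have h1 : B p v = 0 := (hB.2.2 p).2 hv
      have h2 : C p v = 0 := (hC.2.2 p).2 hv
      change B p v + C p v = 0
      rw [h1, h2, add_zero]
  smul_mem' c B hB := by
    refine ⟨hB.1.const_smul c, fun p g v => ?_, fun p => ⟨?_, ?_⟩⟩
    · change c • B _ _ = 𝔓.Tact g p (c • B p v)
      rw [hB.2.1, map_smul]
    · rintro _ ⟨v, rfl⟩
      exact Submodule.smul_mem _ c ((hB.2.2 p).1 ⟨v, rfl⟩)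
    · intro v hv
      have h1 : B p v = 0 := (hB.2.2 p).2 hv
      change c • B p v = 0
      rw [h1, smul_zero]

end PrincipalBundle
end PB

/-! The `T_e G` part of `TG` acts by translation along fundamental vectors, which fill the vertical
spaces. So `Aut_{TG} TP` consists of the smooth `G`-equivariant automorphisms that are the identity
on vertical vectors (`AutTG_apply_vert`, `mem_AutTG`). The rest is largely linear algebra of `0 →
T^v_p P → T_p P → T_{μ(p)} M → 0`.

Such an `A` acts on the quotient `T_{μ(p)} M`. By equivariance and transitivity of `G` on fibres
this action depends only on `μ(p)` (`AutTG_Tproj_apply_congr`), which gives `λ`; locally it is `Tμ ∘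
A ∘ Ts` for a section `s`, hence smooth (`descent_smooth`). The kernel of `λ` consists of the `id +
B` with `B` vanishing on vertical vectors and taking vertical values. Since `B ∘ C = 0` for two such
maps, composition becomes addition (`EndN_apply_add_apply`).

A connection makes `v` determined by the pair `(α v, Tμ v)` (`ext_form_Tproj`), and `σ_α(C)` is the
identity on the first component and `C` on the second. The algebraic claims about `σ_α` are
therefore checked componentwise; its smoothness is `horizontalMap_smooth`. Connections exist by a
partition of unity (`nonempty_connection`), so `λ` is surjective. Each `σ_α` splits the sequence,
and `apply_of_conj` computes the resulting action on `End_N TP`. -/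

/-! ### Smooth families of tangent vectors -/

section Calculus
variable {E H E' H' F K : Type*} [NormedAddCommGroup E] [NormedSpace ℝ E] [TopologicalSpace H]
  [NormedAddCommGroup E'] [NormedSpace ℝ E'] [TopologicalSpace H']
  [NormedAddCommGroup F] [NormedSpace ℝ F] [TopologicalSpace K]
  {I : ModelWithCorners ℝ E H} {I' : ModelWithCorners ℝ E' H'} {J : ModelWithCorners ℝ F K}
  {X Y N : Type*} [TopologicalSpace X] [ChartedSpace H X] [TopologicalSpace Y] [ChartedSpace H' Y]
  [TopologicalSpace N] [ChartedSpace K N]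

/-- The partial differential of a map smooth in two variables, applied to a smooth family of tangent
vectors in the second variable, is a smooth family of tangent vectors. -/
theorem ContMDiffAt.partial_tangentMap [IsManifold I ∞ X] [IsManifold I' ∞ Y] [IsManifold J ∞ N]
    {f : N → X → Y} {V : N → TangentBundle I X} {n : N}
    (hf : ContMDiffAt (J.prod I) I' ∞ (Function.uncurry f) (n, (V n).proj))
    (hV : ContMDiffAt J I.tangent ∞ V n) :
    ContMDiffAt J I'.tangent ∞ (fun k => (⟨f k (V k).proj,
      mfderiv I I' (f k) (V k).proj (V k).snd⟩ : TangentBundle I' Y)) n := by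
  have hp : ContMDiffAt J I ∞ (fun k => (V k).proj) n :=
    ContMDiffAt.comp (g := fun v : TangentBundle I X => v.proj) n
      (contMDiffAt_proj (TangentSpace I)) hV
  have h1 := ContMDiffAt.mfderiv (m := ∞) (n := ∞) (x₀ := n) f (fun k => (V k).proj) hf hp (by simp)
  exact ContMDiffAt.clm_apply_of_inCoordinates (E₁ := (TangentSpace I : X → Type _))
    (E₂ := (TangentSpace I' : Y → Type _)) (v := fun k => (V k).snd) h1 hV
    (ContMDiffAt.comp (g := Function.uncurry f) n hf (contMDiffAt_id.prodMk hp))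

theorem ContMDiffAt.tangent_add [IsManifold I ∞ X] {b : N → X} {V W : ∀ k, TangentSpace I (b k)} {n : N}
    (hV : ContMDiffAt J I.tangent ∞ (fun k => (⟨b k, V k⟩ : TangentBundle I X)) n)
    (hW : ContMDiffAt J I.tangent ∞ (fun k => (⟨b k, W k⟩ : TangentBundle I X)) n) :
    ContMDiffAt J I.tangent ∞ (fun k => (⟨b k, V k + W k⟩ : TangentBundle I X)) n := by
  rw [contMDiffAt_totalSpace] at *
  refine ⟨hV.1, (hV.2.add hW.2).congr_of_eventuallyEq ?_⟩
  filter_upwards [hV.1.continuousAt.eventually ((trivializationAt E (TangentSpace I) (b n)).open_baseSet.mem_nhds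
    (mem_baseSet_trivializationAt E (TangentSpace I) (b n)))] with k hk
  simp only [Pi.add_apply, tangent_coord_linear _ hk]
  exact map_add _ _ _

/-- A smooth function into a fixed tangent space is a smooth family of tangent vectors. -/
theorem ContMDiffAt.tangent_const [IsManifold I ∞ X] {x : X} {V : N → TangentSpace I x} {n : N}
    (hV : ContMDiffAt (M' := E) J 𝓘(ℝ, E) ∞ V n) :
    ContMDiffAt J I.tangent ∞ (fun k => (⟨x, V k⟩ : TangentBundle I X)) n := by
  rw [contMDiffAt_totalSpace]
  refine ⟨contMDiffAt_const, ?_⟩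
  let φ : E →L[ℝ] E := ((trivializationAt E (TangentSpace I) x).continuousLinearEquivAt
    ℝ x (mem_baseSet_trivializationAt E (TangentSpace I) x)).toContinuousLinearMap
  exact ContMDiffAt.comp (g := fun w : E => φ w) n φ.contMDiffAt hV

theorem ContMDiffAt.of_tangent_const [IsManifold I ∞ X] {x : X} {V : N → TangentSpace I x} {n : N}
    (hV : ContMDiffAt J I.tangent ∞ (fun k => (⟨x, V k⟩ : TangentBundle I X)) n) :
    ContMDiffAt (M' := E) J 𝓘(ℝ, E) ∞ V n := by
  rw [contMDiffAt_totalSpace] at hV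
  let φ := (trivializationAt E (TangentSpace I) x).continuousLinearEquivAt
    ℝ x (mem_baseSet_trivializationAt E (TangentSpace I) x)
  let ψ : E →L[ℝ] E := φ.symm.toContinuousLinearMap
  refine (ContMDiffAt.comp (g := fun w : E => ψ w) n ψ.contMDiffAt hV.2).congr_of_eventuallyEq
    (Filter.Eventually.of_forall fun k => ?_)
  exact (φ.symm_apply_apply (V k)).symm

/-- Base points such as `p·1` and `p`, or `μ(pg)` and `μ(p)`, agree only propositionally. All
tangent spaces are copies of the model space, so the comparison can be made there without transport.
-/
theorem tangent_apply_congr {x y : X} (h : x = y) (φ : ∀ x : X, TangentSpace I x →L[ℝ] E') (w : E) :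
    (φ x : E →L[ℝ] E') w = (φ y : E →L[ℝ] E') w := by
  subst h; rfl

theorem mfderiv_apply_of_leftInverse [IsManifold I ∞ X] [IsManifold I' ∞ Y] {f : X → Y} {g : Y → X} {x : X}
    (hf : MDifferentiableAt I I' f x) (hg : MDifferentiableAt I' I g (f x))
    (h : g ∘ f =ᶠ[nhds x] id) (v : TangentSpace I x) :
    (mfderiv I' I g (f x) : E' →L[ℝ] E) (mfderiv I I' f x v : E') = v := by
  have h1 := mfderiv_comp (I'' := I) x hg hf
  rw [h.mfderiv_eq, mfderiv_id] at h1
  exact (DFunLike.congr_fun h1 v).symm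

theorem tangentBundle_mk_eq {x y : X} (h : x = y) {v w : E} (hv : v = w) :
    (⟨x, v⟩ : TangentBundle I X) = ⟨y, w⟩ := by
  subst h hv; rfl

end Calculus

set_option linter.unusedSectionVars false

/-! ### Fibres and translations of a principal bundle -/

section Principal
variable {EM HM EG HG EP HP : Type*}
  [NormedAddCommGroup EM] [NormedSpace ℝ EM] [TopologicalSpace HM]
  [NormedAddCommGroup EG] [NormedSpace ℝ EG] [TopologicalSpace HG]
  [NormedAddCommGroup EP] [NormedSpace ℝ EP] [TopologicalSpace HP]
  {IM : ModelWithCorners ℝ EM HM} {IG : ModelWithCorners ℝ EG HG} {IP : ModelWithCorners ℝ EP HP}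
  {M G P : Type*} [TopologicalSpace M] [ChartedSpace HM M]
  [TopologicalSpace G] [ChartedSpace HG G] [Group G] [TopologicalSpace P] [ChartedSpace HP P]
  [IsManifold IM ∞ M] [LieGroup IG ∞ G] [IsManifold IP ∞ P]

namespace PrincipalBundle
variable (𝔓 : PrincipalBundle IM IG IP M G P)

theorem act_act_inv (p : P) (g : G) : 𝔓.act (𝔓.act p g) g⁻¹ = p := by
  rw [← 𝔓.act_mul, mul_inv_cancel, 𝔓.act_one]

theorem mdiff_act_fst (g : G) (p : P) : MDifferentiableAt IP IP (fun q => 𝔓.act q g) p :=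
  ((𝔓.contMDiff_act.comp (contMDiff_id.prodMk contMDiff_const)) p).mdifferentiableAt (by simp)

theorem Tproj_Tact (p : P) (g : G) (v : TangentSpace IP p) :
    (𝔓.Tproj (𝔓.act p g) (𝔓.Tact g p v) : EM) = 𝔓.Tproj p v := by
  have h := mfderiv_comp (I'' := IM) p (𝔓.mdiff_proj (𝔓.act p g)) (𝔓.mdiff_act_fst g p)
  have hc : 𝔓.proj ∘ (fun q => 𝔓.act q g) = 𝔓.proj := funext fun q => 𝔓.proj_act q g
  rw [hc] at h
  exact (DFunLike.congr_fun h v).symm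

theorem Tact_injective (g : G) (p : P) : Function.Injective (𝔓.Tact g p) := by
  intro v w h
  have key := mfderiv_apply_of_leftInverse (𝔓.mdiff_act_fst g p) (𝔓.mdiff_act_fst g⁻¹ (𝔓.act p g))
    (Filter.Eventually.of_forall fun q => 𝔓.act_act_inv q g)
  exact (key v).symm.trans ((congrArg (fun u : EP =>
    (mfderiv IP IP (fun q => 𝔓.act q g⁻¹) (𝔓.act p g) : EP →L[ℝ] EP) u) h).trans (key w))

/-- In a trivialization, `g` is the quotient of the two fibre coordinates. -/
theorem exists_act_eq {p q : P} (h : 𝔓.proj p = 𝔓.proj q) : ∃ g, 𝔓.act p g = q := by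
  obtain ⟨U, e, -, hm, hs, -, -, -, he1, hea⟩ := 𝔓.exists_trivialization (𝔓.proj p)
  have hp : p ∈ e.source := by rw [hs]; exact hm
  have hq : q ∈ e.source := by rw [hs, mem_preimage, ← h]; exact hm
  refine ⟨(e p).2⁻¹ * (e q).2, e.injOn ?_ hq ?_⟩
  · rw [hs, mem_preimage, 𝔓.proj_act]; exact hm
  · rw [hea p hp, he1 p hp, h, ← he1 q hq]
    simp

theorem proj_surjective : Function.Surjective 𝔓.proj := fun m => by
  obtain ⟨U, e, -, hm, -, ht, -, -, he1, -⟩ := 𝔓.exists_trivialization m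
  have h : (m, (1 : G)) ∈ e.target := by rw [ht]; exact ⟨hm, mem_univ _⟩
  exact ⟨e.symm (m, 1), by rw [← he1 _ (e.map_target h), e.right_inv h]⟩

/-! ### Rigidity on vertical vectors; `End_N TP` and `Aut_N TP` -/

section AutTG
variable [FiniteDimensional ℝ EP] {𝔓}

theorem AutTG_apply_Tact (A : 𝔓.AutTG) (g : G) (p : P) (v : TangentSpace IP p) :
    A.1 (𝔓.act p g) (𝔓.Tact g p v) = 𝔓.Tact g p (A.1 p v) := by
  have h := A.2.2 g 0 p v
  simpa only [tangentAct, map_zero, add_zero] using h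

/-- This is equivariance under `Φ_{(e,X)}` at `v = 0`. The remaining factor `Tκ_e` is cancelled by
injectivity, which avoids identifying `p·e` with `p`. -/
theorem AutTG_apply_fund (A : 𝔓.AutTG) (p : P) (X : TangentSpace IG (1 : G)) :
    A.1 p (𝔓.fund p X) = 𝔓.fund p X := by
  have h := A.2.2 1 X p 0
  simp only [tangentAct, zero_add, map_zero] at h
  rw [AutTG_apply_Tact] at h
  exact 𝔓.Tact_injective _ _ h

theorem AutTG_apply_vert (A : 𝔓.AutTG) (p : P) {v : TangentSpace IP p} (hv : 𝔓.Tproj p v = 0) :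
    A.1 p v = v := by
  obtain ⟨X, rfl⟩ := 𝔓.vert_le_range_fund p v hv
  exact AutTG_apply_fund A p X

theorem mem_AutTG {A : ∀ p : P, TangentSpace IP p ≃L[ℝ] TangentSpace IP p}
    (hA : IsSmoothTangentEndo (fun p => (A p : TangentSpace IP p →L[ℝ] TangentSpace IP p)))
    (hact : ∀ p g v, A (𝔓.act p g) (𝔓.Tact g p v) = 𝔓.Tact g p (A p v))
    (hfund : ∀ p X, A p (𝔓.fund p X) = 𝔓.fund p X) : A ∈ 𝔓.AutTG :=
  ⟨hA, fun g X p v => by simp only [tangentAct, hact, map_add, hfund]⟩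

theorem AutTG_ext {A B : 𝔓.AutTG} (h : ∀ p v, A.1 p v = B.1 p v) : A = B :=
  Subtype.ext (funext fun p => ContinuousLinearEquiv.ext (funext (h p)))

theorem EndN_Tproj (B : 𝔓.EndN) (p : P) (v : TangentSpace IP p) : 𝔓.Tproj p (B.1 p v) = 0 :=
  (B.2.2.2 p).1 ⟨v, rfl⟩

theorem EndN_apply_vert (B : 𝔓.EndN) (p : P) {v : TangentSpace IP p} (hv : 𝔓.Tproj p v = 0) :
    B.1 p v = 0 :=
  (B.2.2.2 p).2 hv

/-- `B ∘ C = 0`, because `C` has vertical values and `B` kills vertical vectors. This makes `id - B`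
inverse to `id + B` and turns composition into addition. -/
theorem EndN_apply_add_apply (B C : 𝔓.EndN) (p : P) (v : TangentSpace IP p) :
    B.1 p (v + C.1 p v) = B.1 p v := by
  rw [map_add, EndN_apply_vert B p (EndN_Tproj C p v), add_zero]

/-- The family `p ↦ id + B p` of linear isomorphisms. -/
noncomputable def oneAdd (B : 𝔓.EndN) (p : P) : TangentSpace IP p ≃L[ℝ] TangentSpace IP p :=
  ContinuousLinearEquiv.equivOfInverse (ContinuousLinearMap.id ℝ _ + B.1 p)
    (ContinuousLinearMap.id ℝ _ + (-B).1 p)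
    (fun v => by
      change v + B.1 p v + (-B).1 p (v + B.1 p v) = v
      rw [EndN_apply_add_apply]
      change v + B.1 p v + -(B.1 p v) = v
      abel)
    (fun v => by
      change v + (-B).1 p v + B.1 p (v + (-B).1 p v) = v
      rw [EndN_apply_add_apply]
      change v + -(B.1 p v) + B.1 p v = v
      abel)

theorem oneAdd_mem (B : 𝔓.EndN) : oneAdd B ∈ 𝔓.AutTG := by
  refine mem_AutTG ?_ (fun p g v => ?_) (fun p X => ?_)
  · exact IsSmoothTangentEndo.add (B := fun p => ContinuousLinearMap.id ℝ (TangentSpace IP p))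
      contMDiff_id B.2.1
  · change 𝔓.Tact g p v + B.1 _ _ = 𝔓.Tact g p (v + B.1 p v)
    rw [B.2.2.1, map_add]
  · change 𝔓.fund p X + B.1 _ _ = _
    rw [EndN_apply_vert B p (𝔓.Tproj_fund p X), add_zero]

theorem AutN_sub_mem (A : 𝔓.AutN) :
    (fun p => (A.1.1 p : TangentSpace IP p →L[ℝ] TangentSpace IP p) + (-1 : ℝ) • ContinuousLinearMap.id ℝ _)
      ∈ 𝔓.EndN := by
  have key : ∀ p (v : TangentSpace IP p), ((A.1.1 p : TangentSpace IP p →L[ℝ] TangentSpace IP p) +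
      (-1 : ℝ) • ContinuousLinearMap.id ℝ (TangentSpace IP p) : TangentSpace IP p →L[ℝ] TangentSpace IP p) v = A.1.1 p v - v := fun p v => by
    change A.1.1 p v + (-1 : ℝ) • v = _
    rw [neg_one_smul, sub_eq_add_neg]
  refine ⟨?_, fun p g v => ?_, fun p => ⟨?_, fun v hv => ?_⟩⟩
  · exact IsSmoothTangentEndo.add A.1.2.1 (IsSmoothTangentEndo.const_smul (-1)
      (B := fun p => ContinuousLinearMap.id ℝ (TangentSpace IP p)) contMDiff_id)
  · rw [key, key, AutTG_apply_Tact, map_sub]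
  · rintro _ ⟨v, rfl⟩
    have := A.2 p v
    rw [← key] at this
    exact this
  · refine (key p v).trans ?_
    rw [AutTG_apply_vert A.1 p hv, sub_self]

variable (𝔓) in
/-- The isomorphism `B ↦ id + B` of the additive group `End_N TP` onto `Aut_N TP`. -/
noncomputable def EndNEquiv : Multiplicative 𝔓.EndN ≃* 𝔓.AutN where
  toFun B := ⟨⟨oneAdd B.toAdd, oneAdd_mem _⟩, fun p v => by
    change v + B.toAdd.1 p v - v ∈ _
    rw [add_sub_cancel_left]
    exact EndN_Tproj _ p v⟩
  invFun A := Multiplicative.ofAdd ⟨_, AutN_sub_mem A⟩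
  left_inv B := by
    refine congrArg Multiplicative.ofAdd (Subtype.ext (funext fun p => ContinuousLinearMap.ext fun v => ?_))
    change v + B.toAdd.1 p v + (-1 : ℝ) • v = B.toAdd.1 p v
    rw [neg_one_smul]; abel
  right_inv A := by
    refine Subtype.ext (AutTG_ext fun p v => ?_)
    change v + (A.1.1 p v + (-1 : ℝ) • v) = A.1.1 p v
    rw [neg_one_smul]; abel
  map_mul' B C := by
    refine Subtype.ext (AutTG_ext fun p v => ?_)
    change v + (B.toAdd.1 p v + C.toAdd.1 p v) = v + C.toAdd.1 p v + B.toAdd.1 p (v + C.toAdd.1 p v)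
    rw [EndN_apply_add_apply]; abel

end AutTG

/-- Through every point of `P` passes a smooth local section of the projection. -/
theorem exists_contMDiffAt_section (p : P) : ∃ s : M → P, ContMDiffAt IM IP ∞ s (𝔓.proj p) ∧
    ∀ᶠ m in nhds (𝔓.proj p), 𝔓.proj (s m) = m := by
  obtain ⟨U, e, hU, hpU, hs, ht, -, hes, he1, -⟩ := 𝔓.exists_trivialization (𝔓.proj p)
  refine ⟨fun m => e.symm (m, 1), ?_, ?_⟩
  · have hm : (𝔓.proj p, (1 : G)) ∈ e.target := by rw [ht]; exact ⟨hpU, mem_univ _⟩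
    exact ContMDiffAt.comp (g := e.symm) (f := fun m => (m, (1 : G))) _
      ((hes _ hm).contMDiffAt (e.open_target.mem_nhds hm)) (contMDiffAt_id.prodMk contMDiffAt_const)
  · filter_upwards [hU.mem_nhds hpU] with m hm
    have h : (m, (1 : G)) ∈ e.target := by rw [ht]; exact ⟨hm, mem_univ _⟩
    rw [← he1 _ (e.map_target h), e.right_inv h]

/-- A family of endomorphisms of `TM` is determined by its composition with `Tμ`. -/
theorem eq_of_comp_Tproj {C D : ∀ m : M, TangentSpace IM m →L[ℝ] TangentSpace IM m}
    (h : ∀ p v, C (𝔓.proj p) (𝔓.Tproj p v) = D (𝔓.proj p) (𝔓.Tproj p v)) (m : M)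
    (w : TangentSpace IM m) : C m w = D m w := by
  obtain ⟨p, rfl⟩ := 𝔓.proj_surjective m
  obtain ⟨v, rfl⟩ := 𝔓.Tproj_surjective p w
  exact h p v

/-! ### The induced automorphism of `TM` -/

section AutTG
variable [FiniteDimensional ℝ EP] {𝔓}

/-- Well-definedness of `λ`. With `q = pg`, the difference `w - Tκ_g v` is vertical, hence fixed by
`A`, so `A w` and `Tκ_g (A v)` have the same projection. -/
theorem AutTG_Tproj_apply_congr (A : 𝔓.AutTG) {p q : P} (h : 𝔓.proj p = 𝔓.proj q)
    (v : TangentSpace IP p) (w : TangentSpace IP q) (hvw : (𝔓.Tproj p v : EM) = 𝔓.Tproj q w) :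
    (𝔓.Tproj p (A.1 p v) : EM) = 𝔓.Tproj q (A.1 q w) := by
  obtain ⟨g, rfl⟩ := 𝔓.exists_act_eq h
  have h0 : 𝔓.Tproj (𝔓.act p g) (w - 𝔓.Tact g p v) = 0 := by
    rw [map_sub, sub_eq_zero]
    exact hvw.symm.trans (𝔓.Tproj_Tact p g v).symm
  have h1 := AutTG_apply_vert A _ h0
  rw [map_sub, AutTG_apply_Tact] at h1
  have h2 := congrArg (𝔓.Tproj (𝔓.act p g)) h1
  rw [h0, map_sub, sub_eq_zero] at h2
  exact (𝔓.Tproj_Tact p g _).symm.trans (Eq.symm h2)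

variable [FiniteDimensional ℝ EM]

theorem exists_descent (A : 𝔓.AutTG) : ∃ C : ∀ m : M, TangentSpace IM m →L[ℝ] TangentSpace IM m,
    ∀ p v, C (𝔓.proj p) (𝔓.Tproj p v) = 𝔓.Tproj p (A.1 p v) := by
  -- The points `pt m` and the linear right inverses `R` of `Tμ` are chosen without any regularity;
  -- independence of the choice is what gives the formula at every `p`.
  choose pt hpt using 𝔓.proj_surjective
  have hR : ∀ p, ∃ R : EM →ₗ[ℝ] EP, ∀ w, (𝔓.Tproj p : EP →L[ℝ] EM) (R w) = w := fun p => by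
    let T : EP →L[ℝ] EM := 𝔓.Tproj p
    obtain ⟨R, hR⟩ := LinearMap.exists_rightInverse_of_surjective T.toLinearMap (LinearMap.range_eq_top.2 (𝔓.Tproj_surjective p))
    exact ⟨R, fun w => LinearMap.congr_fun hR w⟩
  choose R hR using hR
  refine ⟨fun m => ((𝔓.Tproj (pt m) : EP →L[ℝ] EM) ∘L (A.1 (pt m) : EP ≃L[ℝ] EP).toContinuousLinearMap ∘L
    LinearMap.toContinuousLinearMap (R (pt m)) : EM →L[ℝ] EM), fun p v => ?_⟩
  exact AutTG_Tproj_apply_congr A (hpt _) (R (pt (𝔓.proj p)) (𝔓.Tproj p v)) v (hR _ _)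

/-- The automorphism of `TM` induced by an element of `Aut_{TG} TP`, as a family of linear maps. -/
noncomputable def descent (A : 𝔓.AutTG) : ∀ m : M, TangentSpace IM m →L[ℝ] TangentSpace IM m :=
  (exists_descent A).choose

theorem descent_Tproj (A : 𝔓.AutTG) (p : P) (v : TangentSpace IP p) :
    descent A (𝔓.proj p) (𝔓.Tproj p v) = 𝔓.Tproj p (A.1 p v) :=
  (exists_descent A).choose_spec p v

theorem descent_mul (A B : 𝔓.AutTG) (m : M) (w : TangentSpace IM m) :
    descent (A * B) m w = descent A m (descent B m w) := by
  refine 𝔓.eq_of_comp_Tproj (D := fun m => (descent A m).comp (descent B m)) (fun p v => ?_) m w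
  rw [ContinuousLinearMap.comp_apply, descent_Tproj, descent_Tproj, descent_Tproj]
  rfl

theorem descent_one (m : M) (w : TangentSpace IM m) : descent (1 : 𝔓.AutTG) m w = w := by
  refine 𝔓.eq_of_comp_Tproj (D := fun m => ContinuousLinearMap.id ℝ _) (fun p v => ?_) m w
  rw [descent_Tproj]
  rfl

/-- Near a point, `λ(A) = Tμ ∘ A ∘ Ts` for a smooth local section `s`, a composite of smooth maps.
-/
theorem descent_smooth (A : 𝔓.AutTG) : IsSmoothTangentEndo (descent A) := by
  intro v
  obtain ⟨p, hp⟩ := 𝔓.proj_surjective v.proj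
  obtain ⟨s, hs, hsec⟩ := 𝔓.exists_contMDiffAt_section p
  rw [hp] at hs hsec
  have h1 : ContMDiffAt IM.tangent IP.tangent ∞ (fun w : TangentBundle IM M =>
      (⟨s w.proj, mfderiv IM IP s w.proj w.snd⟩ : TangentBundle IP P)) v := by
    refine ContMDiffAt.partial_tangentMap (f := fun _ => s) (V := id) ?_ contMDiffAt_id
    exact ContMDiffAt.comp (g := s) (f := Prod.snd) (v, v.proj) hs contMDiffAt_snd
  have h2 := ContMDiffAt.comp (I'' := IP.tangent) v (A.2.1.contMDiffAt) h1
  have h3 := ContMDiffAt.comp (I'' := IM.tangent) v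
    ((𝔓.contMDiff_proj.contMDiff_tangentMap (m := ∞) (by simp)).contMDiffAt) h2
  refine h3.congr_of_eventuallyEq ?_
  -- Being `C^1` at a point is an open condition, so the chain rule for `μ ∘ s = id` is available at
  -- all nearby points.
  have hsm : ∀ᶠ m in nhds v.proj, MDifferentiableAt IM IP s m := by
    have hs1 : ContMDiffAt IM IP 1 s v.proj := hs.of_le (by simp)
    filter_upwards [(contMDiffAt_iff_contMDiffAt_nhds (by simp)).1 hs1] with m hm
    exact hm.mdifferentiableAt (by simp)
  have hcont := (FiberBundle.continuous_proj EM (TangentSpace IM : M → Type _)).continuousAt (x := v)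
  filter_upwards [hcont.eventually hsm, hcont.eventually hsec.eventually_nhds] with w hw1 hw2
  have hw3 : 𝔓.proj (s w.proj) = w.proj := hw2.self_of_nhds
  refine tangentBundle_mk_eq hw3.symm ?_
  have h4 := mfderiv_apply_of_leftInverse hw1 (𝔓.mdiff_proj _) hw2 w.snd
  have h5 := descent_Tproj A (s w.proj) (mfderiv IM IP s w.proj w.snd)
  refine Eq.trans ?_ h5
  refine Eq.trans ?_ (tangent_apply_congr hw3.symm (fun m => descent A m) _)
  exact congrArg (fun u : EM => (descent A w.proj : EM →L[ℝ] EM) u) h4.symm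

variable (𝔓) in
/-- The homomorphism `λ : Aut_{TG} TP → Aut₀ TM`. -/
noncomputable def autProj : 𝔓.AutTG →* TangentAut IM M :=
  MonoidHom.mk' (fun A => ⟨fun m => ContinuousLinearEquiv.equivOfInverse (descent A m) (descent A⁻¹ m)
    (fun w => by rw [← descent_mul, inv_mul_cancel, descent_one])
    (fun w => by rw [← descent_mul, mul_inv_cancel, descent_one]), descent_smooth A⟩)
    fun A B => Subtype.ext (funext fun m => ContinuousLinearEquiv.ext (funext (descent_mul A B m)))

theorem autProj_Tproj (A : 𝔓.AutTG) (p : P) (v : TangentSpace IP p) :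
    (autProj 𝔓 A).1 (𝔓.proj p) (𝔓.Tproj p v) = 𝔓.Tproj p (A.1 p v) :=
  descent_Tproj A p v

variable (𝔓) in
theorem TangentAut_ext_Tproj {C D : TangentAut IM M}
    (h : ∀ p v, C.1 (𝔓.proj p) (𝔓.Tproj p v) = D.1 (𝔓.proj p) (𝔓.Tproj p v)) : C = D :=
  Subtype.ext (funext fun m => ContinuousLinearEquiv.ext (funext
    (𝔓.eq_of_comp_Tproj (C := fun m => C.1 m) (D := fun m => D.1 m) h m)))

theorem autProj_eq_iff (A : 𝔓.AutTG) (C : TangentAut IM M) : 𝔓.autProj A = C ↔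
    ∀ p v, C.1 (𝔓.proj p) (𝔓.Tproj p v) = 𝔓.Tproj p (A.1 p v) := by
  refine ⟨?_, fun h => 𝔓.TangentAut_ext_Tproj fun p v => ?_⟩
  · rintro rfl; exact autProj_Tproj A
  · rw [autProj_Tproj, h]

theorem autProj_ker : 𝔓.autProj.ker = 𝔓.AutN := by
  ext A
  rw [MonoidHom.mem_ker, autProj_eq_iff]
  refine forall₂_congr fun p v => ?_
  change 𝔓.Tproj p v = _ ↔ 𝔓.Tproj p (A.1 p v - v) = 0
  rw [map_sub, sub_eq_zero, eq_comm]

end AutTG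

/-! ### Existence of connections -/

/-- The left logarithmic differential of the fibre coordinate of a local trivialization is a connection
form over the domain of the trivialization. -/
theorem exists_local_connection (m : M) : ∃ (U : Set M)
    (a : ∀ p : P, TangentSpace IP p →L[ℝ] TangentSpace IG (1 : G)), IsOpen U ∧ m ∈ U ∧
    (∀ v : TangentBundle IP P, 𝔓.proj v.proj ∈ U → ContMDiffAt (M' := EG) IP.tangent 𝓘(ℝ, EG) ∞
      (fun w : TangentBundle IP P => a w.proj w.snd) v) ∧
    (∀ p, 𝔓.proj p ∈ U → ∀ X, a p (𝔓.fund p X) = X) ∧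
    (∀ p, 𝔓.proj p ∈ U → ∀ g v, a (𝔓.act p g) (𝔓.Tact g p v) = Ad IG G g⁻¹ (a p v)) := by
  obtain ⟨U, e, hU, hm, hs, -, he, -, -, hea⟩ := 𝔓.exists_trivialization m
  have hes : ∀ {p}, 𝔓.proj p ∈ U → p ∈ e.source := fun {p} hp => by rw [hs]; exact hp
  have hsm : ∀ {p}, 𝔓.proj p ∈ U → ContMDiffAt IP IG ∞ (fun q => (e q).2) p := fun hp =>
    contMDiffAt_snd.comp _ ((he _ (hes hp)).contMDiffAt (e.open_source.mem_nhds (hes hp)))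
  have hfm : ∀ {p}, 𝔓.proj p ∈ U → ∀ g : G, MDifferentiableAt IP IG (fun q => g * (e q).2) p := fun hp g =>
    ((contMDiff_mul_left (I := IG) (n := ∞) (a := g)).contMDiffAt.comp _ (hsm hp)).mdifferentiableAt (by simp)
  have hloc : ∀ {p}, 𝔓.proj p ∈ U → ∀ᶠ q in nhds p, q ∈ e.source := fun hp =>
    e.open_source.mem_nhds (hes hp)
  refine ⟨U, fun p => (mfderiv IP IG (fun q => (e p).2⁻¹ * (e q).2) p : EP →L[ℝ] EG), hU, hm,
    fun v hv => ?_, fun p hp X => ?_, fun p hp g v => ?_⟩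
  · have h1 : ContMDiffAt IP.tangent IG.tangent ∞ (fun w : TangentBundle IP P =>
        (⟨(e w.proj).2⁻¹ * (e w.proj).2, mfderiv IP IG (fun q => (e w.proj).2⁻¹ * (e q).2) w.proj w.snd⟩ :
          TangentBundle IG G)) v := by
      refine ContMDiffAt.partial_tangentMap (f := fun (w : TangentBundle IP P) q =>
        (e w.proj).2⁻¹ * (e q).2) (V := id) ?_ contMDiffAt_id
      refine ContMDiffAt.mul (ContMDiffAt.inv ?_) ?_
      · exact ContMDiffAt.comp (g := fun q => (e q).2)
          (f := fun x : TangentBundle IP P × P => x.1.proj) (v, v.proj) (hsm hv)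
          (ContMDiffAt.comp (g := fun w : TangentBundle IP P => w.proj) (v, v.proj)
            (contMDiffAt_proj (TangentSpace IP)) contMDiffAt_fst)
      · exact ContMDiffAt.comp (g := fun q => (e q).2) (f := Prod.snd) (v, v.proj) (hsm hv) contMDiffAt_snd
    -- The base point `(e p).2⁻¹ * (e p).2` is constantly `1`, so the smooth family in `TG` is a
    -- smooth function into `T_e G`.
    refine ContMDiffAt.of_tangent_const (x := (1 : G)) (h1.congr_of_eventuallyEq
      (Filter.Eventually.of_forall fun w => ?_))
    exact tangentBundle_mk_eq (inv_mul_cancel _).symm rfl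
  · have hp1 : 𝔓.proj (𝔓.act p 1) ∈ U := by rw [𝔓.proj_act]; exact hp
    have h := mfderiv_comp (I'' := IG) (1 : G) (hfm hp1 (e p).2⁻¹) (𝔓.mdiff_act_snd p 1)
    -- By equivariance of the trivialization, `pg` has fibre coordinate `(e p).2 * g`.
    have hc : (fun q => (e p).2⁻¹ * (e q).2) ∘ 𝔓.act p = id := funext fun g => by
      simp [hea p (hes hp)]
    rw [hc, mfderiv_id] at h
    exact (tangent_apply_congr (𝔓.act_one p).symm
      (fun q => (mfderiv IP IG (fun q => (e p).2⁻¹ * (e q).2) q : EP →L[ℝ] EG)) _).trans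
      (DFunLike.congr_fun h X).symm
  · have hpg : 𝔓.proj (𝔓.act p g) ∈ U := by rw [𝔓.proj_act]; exact hp
    have h := mfderiv_comp (I'' := IG) p (hfm hpg (e (𝔓.act p g)).2⁻¹) (𝔓.mdiff_act_fst g p)
    have hcm : ∀ x : G, MDifferentiableAt IG IG (fun x => g⁻¹ * x * g⁻¹⁻¹) x := fun x =>
      ((contMDiff_mul_right (I := IG) (n := ∞) (a := g⁻¹⁻¹)).comp
        (contMDiff_mul_left (I := IG) (n := ∞) (a := g⁻¹))).mdifferentiableAt (by simp)
    have h' := mfderiv_comp (I'' := IG) p (hcm _) (hfm hp (e p).2⁻¹)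
    -- Translating both points by `g` conjugates the quotient of their fibre coordinates by `g⁻¹`;
    -- differentiating at `p` produces `Ad_{g⁻¹}`.
    have hc : (fun q => (e (𝔓.act p g)).2⁻¹ * (e q).2) ∘ (fun q => 𝔓.act q g) =ᶠ[nhds p]
        (fun x => g⁻¹ * x * g⁻¹⁻¹) ∘ (fun q => (e p).2⁻¹ * (e q).2) := by
      filter_upwards [hloc hp] with q hq
      simp [hea p (hes hp), hea q hq, mul_assoc]
    rw [hc.mfderiv_eq, h'] at h
    refine (DFunLike.congr_fun h v).symm.trans ?_
    exact tangent_apply_congr (inv_mul_cancel (e p).2)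
      (fun x => (mfderiv IG IG (fun x => g⁻¹ * x * g⁻¹⁻¹) x : EG →L[ℝ] EG)) _

/-- Every smooth principal bundle over a second countable Hausdorff manifold has a connection. -/
theorem nonempty_connection [FiniteDimensional ℝ EM] [T2Space M] [SecondCountableTopology M] :
    Nonempty 𝔓.Connection := by
  have : LocallyCompactSpace HM := IM.locallyCompactSpace
  have : LocallyCompactSpace M := ChartedSpace.locallyCompactSpace HM M
  choose U a hU hmem ha hfund hact using 𝔓.exists_local_connection
  -- The partition lives on `M`, so the weights `ρ i ∘ μ` are `G`-invariant and equivariance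
  -- survives averaging; total weight `1` preserves the normalization on fundamental vectors.
  obtain ⟨ρ, hρ⟩ := SmoothPartitionOfUnity.exists_isSubordinate IM isClosed_univ U hU
    (fun m _ => mem_iUnion.2 ⟨m, hmem m⟩)
  have hρU : ∀ {i p}, ρ i (𝔓.proj p) ≠ 0 → 𝔓.proj p ∈ U i := fun {i p} h =>
    hρ i (subset_tsupport _ h)
  have hfin : ∀ p : P, (Function.support fun i => ρ i (𝔓.proj p)).Finite := fun p =>
    ρ.locallyFinite.point_finite (𝔓.proj p)
  let a' : M → ∀ p : P, EP →L[ℝ] EG := a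
  have hform : ∀ (p : P) (v : EP), (∑ᶠ i, ρ i (𝔓.proj p) • a' i p : EP →L[ℝ] EG) v =
      ∑ᶠ i, ρ i (𝔓.proj p) • a' i p v := fun p v =>
    (ContinuousLinearMap.apply ℝ EG v).toLinearMap.toAddMonoidHom.map_finsum
      ((hfin p).subset fun i hi h0 => hi (by
        simp only [show ρ i (𝔓.proj p) = 0 from h0, zero_smul]))
  refine ⟨⟨fun p => (∑ᶠ i, ρ i (𝔓.proj p) • a' i p : EP →L[ℝ] EG), ?_, fun p X => ?_, fun p g v => ?_⟩⟩
  · have hpr : Continuous fun w : TangentBundle IP P => 𝔓.proj w.proj :=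
      𝔓.contMDiff_proj.continuous.comp (FiberBundle.continuous_proj EP (TangentSpace IP))
    have hprs : ContMDiff IP.tangent IM ∞ fun w : TangentBundle IP P => 𝔓.proj w.proj :=
      𝔓.contMDiff_proj.comp (Bundle.contMDiff_proj (TangentSpace IP))
    refine ContMDiff.congr (f := fun w : TangentBundle IP P =>
      ∑ᶠ i, ρ i (𝔓.proj w.proj) • a' i w.proj w.snd) ?_ fun w => hform w.proj w.snd
    refine contMDiff_finsum (fun i v => ?_) ?_
    -- The local form is smooth only over `U i`; off the closed support of `ρ i` the product
    -- vanishes in a neighbourhood.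
    · by_cases hv : 𝔓.proj v.proj ∈ tsupport (ρ i)
      · exact ((ρ i).contMDiff.comp hprs).contMDiffAt.smul (ha i v (hρ i hv))
      · refine (contMDiffAt_const (c := (0 : EG))).congr_of_eventuallyEq ?_
        filter_upwards [hpr.continuousAt.eventually ((isClosed_tsupport (ρ i)).isOpen_compl.mem_nhds hv)]
          with w hw
        rw [image_eq_zero_of_notMem_tsupport hw, zero_smul]
    · exact (ρ.locallyFinite.preimage_continuous hpr).subset fun i w hw h0 =>
        hw (by simp only [h0, zero_smul])
  · refine (hform p (𝔓.fund p X)).trans ?_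
    let Y : EG := X
    have h1 : ∀ i, ρ i (𝔓.proj p) • a' i p (𝔓.fund p X) = ρ i (𝔓.proj p) • Y := fun i => by
      by_cases h : ρ i (𝔓.proj p) = 0
      · rw [h, zero_smul, zero_smul]
      · exact congrArg (fun y : EG => ρ i (𝔓.proj p) • y) (hfund i p (hρU h) X)
    rw [finsum_congr h1, ← finsum_smul' (hfin p), ρ.sum_eq_one (mem_univ _)]
    exact one_smul ℝ Y
  · let L : EG →L[ℝ] EG := Ad IG G g⁻¹
    refine (hform _ _).trans (Eq.trans ?_ (congrArg L (hform p v)).symm)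
    refine Eq.trans ?_ (L.toLinearMap.toAddMonoidHom.map_finsum
      ((hfin p).subset fun i hi h0 => hi (by
        simp only [show ρ i (𝔓.proj p) = 0 from h0, zero_smul]))).symm
    refine finsum_congr fun i => ?_
    change ρ i (𝔓.proj (𝔓.act p g)) • a' i (𝔓.act p g) (𝔓.Tact g p v) = L (ρ i (𝔓.proj p) • a' i p v)
    rw [L.map_smul, 𝔓.proj_act]
    by_cases h : ρ i (𝔓.proj p) = 0
    · rw [h, zero_smul, zero_smul]
    · exact congrArg (fun y : EG => ρ i (𝔓.proj p) • y) (hact i p (hρU h) g v)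

theorem contMDiffAt_fund {E₀ H₀ N : Type*} [NormedAddCommGroup E₀] [NormedSpace ℝ E₀]
    [TopologicalSpace H₀] {J : ModelWithCorners ℝ E₀ H₀} [TopologicalSpace N] [ChartedSpace H₀ N]
    [IsManifold J ∞ N] {b : N → P} {Y : N → TangentSpace IG (1 : G)} {n : N}
    (hb : ContMDiffAt J IP ∞ b n) (hY : ContMDiffAt (M' := EG) J 𝓘(ℝ, EG) ∞ Y n) :
    ContMDiffAt J IP.tangent ∞ (fun k => (⟨b k, 𝔓.fund (b k) (Y k)⟩ : TangentBundle IP P)) n := by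
  have h := ContMDiffAt.partial_tangentMap (f := fun k g => 𝔓.act (b k) g)
    (V := fun k => (⟨1, Y k⟩ : TangentBundle IG G)) (n := n) (I' := IP)
    (𝔓.contMDiff_act.contMDiffAt.comp (n, (1 : G))
      ((ContMDiffAt.comp (g := b) (f := Prod.fst) (n, (1 : G)) hb contMDiffAt_fst).prodMk contMDiffAt_snd))
    (ContMDiffAt.tangent_const hY)
  refine h.congr_of_eventuallyEq (Filter.Eventually.of_forall fun k => ?_)
  exact tangentBundle_mk_eq (𝔓.act_one (b k)).symm rfl

/-! ### The splitting defined by a connection -/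

namespace Connection
variable {𝔓} (α : 𝔓.Connection)

/-- A vector killed by `Tμ` is fundamental, and `α` recovers its generator. Identities in `T_p P`
thus reduce to a vertical and a horizontal component. -/
theorem ext_form_Tproj {p : P} {v w : TangentSpace IP p} (h1 : α.form p v = α.form p w)
    (h2 : 𝔓.Tproj p v = 𝔓.Tproj p w) : v = w := by
  obtain ⟨X, hX⟩ := 𝔓.vert_le_range_fund p (v - w) (by rw [map_sub, h2, sub_self])
  have h3 := α.form_fund p X
  rw [hX, map_sub, h1, sub_self] at h3
  rw [← h3, map_zero] at hX
  exact sub_eq_zero.1 hX.symm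

theorem form_lift (p : P) (w : TangentSpace IM (𝔓.proj p)) : α.form p (α.lift p w) = 0 :=
  ((LinearEquiv.ofBijective _ (α.bijective_Tproj_hor p)).symm w).2

theorem Tproj_lift (p : P) (w : TangentSpace IM (𝔓.proj p)) : 𝔓.Tproj p (α.lift p w) = w :=
  (LinearEquiv.ofBijective _ (α.bijective_Tproj_hor p)).apply_symm_apply w

section Horizontal
variable [FiniteDimensional ℝ EM]

/-- The linear map `Π^v_α(p) + Γ_α(p) ∘ C ∘ T_p μ`. -/
noncomputable def horizontalMap (C : TangentAut IM M) (p : P) : TangentSpace IP p →ₗ[ℝ] TangentSpace IP p :=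
  (α.verticalProj p).toLinearMap + α.lift p ∘ₗ
    ((C.1 (𝔓.proj p) : TangentSpace IM (𝔓.proj p) →L[ℝ] TangentSpace IM (𝔓.proj p)).comp (𝔓.Tproj p)).toLinearMap

theorem horizontalMap_apply (C : TangentAut IM M) (p : P) (v : TangentSpace IP p) :
    α.horizontalMap C p v = α.verticalProj p v + α.lift p (C.1 (𝔓.proj p) (𝔓.Tproj p v)) := rfl

theorem form_horizontalMap (C : TangentAut IM M) (p : P) (v : TangentSpace IP p) :
    α.form p (α.horizontalMap C p v) = α.form p v := by
  rw [horizontalMap_apply, map_add, form_lift, add_zero]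
  exact α.form_fund p _

theorem Tproj_horizontalMap (C : TangentAut IM M) (p : P) (v : TangentSpace IP p) :
    𝔓.Tproj p (α.horizontalMap C p v) = C.1 (𝔓.proj p) (𝔓.Tproj p v) := by
  rw [horizontalMap_apply, map_add, Tproj_lift]
  exact (congrArg (· + _) (𝔓.Tproj_fund p _)).trans (zero_add _)

theorem horizontalMap_mul (C D : TangentAut IM M) (p : P) (v : TangentSpace IP p) :
    α.horizontalMap (C * D) p v = α.horizontalMap C p (α.horizontalMap D p v) := by
  apply α.ext_form_Tproj
  · simp only [form_horizontalMap]
  · simp only [Tproj_horizontalMap]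
    rfl

theorem horizontalMap_one (p : P) (v : TangentSpace IP p) : α.horizontalMap 1 p v = v := by
  apply α.ext_form_Tproj
  · simp only [form_horizontalMap]
  · simp only [Tproj_horizontalMap]
    rfl

theorem horizontalMap_apply_inv (C : TangentAut IM M) (p : P) (v : TangentSpace IP p) :
    α.horizontalMap C p (α.horizontalMap C⁻¹ p v) = v := by
  rw [← horizontalMap_mul, mul_inv_cancel, horizontalMap_one]

theorem horizontalMap_Tact (C : TangentAut IM M) (p : P) (g : G) (v : TangentSpace IP p) :
    α.horizontalMap C (𝔓.act p g) (𝔓.Tact g p v) = 𝔓.Tact g p (α.horizontalMap C p v) := by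
  apply α.ext_form_Tproj
  · simp only [form_horizontalMap, form_Tact]
  · rw [Tproj_horizontalMap]
    have h1 := 𝔓.Tproj_Tact p g (α.horizontalMap C p v)
    rw [Tproj_horizontalMap] at h1
    refine Eq.trans ?_ (Eq.symm h1)
    refine (tangent_apply_congr (𝔓.proj_act p g) (fun m => (C.1 m).toContinuousLinearMap) _).trans ?_
    exact congrArg (fun w : EM => (C.1 (𝔓.proj p) : EM ≃L[ℝ] EM) w) (𝔓.Tproj_Tact p g v)

theorem horizontalMap_fund (C : TangentAut IM M) (p : P) (X : TangentSpace IG (1 : G)) :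
    α.horizontalMap C p (𝔓.fund p X) = 𝔓.fund p X := by
  apply α.ext_form_Tproj
  · rw [form_horizontalMap]
  · rw [Tproj_horizontalMap, 𝔓.Tproj_fund, map_zero]

/-- The lift `Γ_α` is a pointwise inverse, so its smoothness is not visible from its definition. A
trivialization instead gives a smooth lift `L` of `C ∘ Tμ`, and the vertical correction by `α(w) -
α(L w)` turns it into `σ_α(C)`. -/
theorem horizontalMap_smooth (C : TangentAut IM M) (v : TangentBundle IP P) :
    ContMDiffAt IP.tangent IP.tangent ∞ (fun w : TangentBundle IP P =>
      (⟨w.proj, α.horizontalMap C w.proj w.snd⟩ : TangentBundle IP P)) v := by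
  obtain ⟨U, e, hU, hm, hs, ht, he, hes, he1, -⟩ := 𝔓.exists_trivialization (𝔓.proj v.proj)
  have hv : v.proj ∈ e.source := by rw [hs]; exact hm
  have hpr : ContMDiff IP.tangent IP ∞ (fun w : TangentBundle IP P => w.proj) :=
    Bundle.contMDiff_proj (TangentSpace IP)
  have hnear : ∀ᶠ w : TangentBundle IP P in nhds v, w.proj ∈ e.source :=
    hpr.continuous.continuousAt.eventually (e.open_source.mem_nhds hv)
  have hfib : ∀ {p}, p ∈ e.source → (𝔓.proj p, (e p).2) = e p := fun {p} hp => by rw [← he1 p hp]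
  have hmt : ∀ {p}, p ∈ e.source → (𝔓.proj p, (e p).2) ∈ e.target := fun hp => by
    rw [hfib hp]; exact e.map_source hp
  have hsymm : ∀ {x}, x ∈ e.target → ContMDiffAt (IM.prod IG) IP ∞ e.symm x := fun hx =>
    (hes _ hx).contMDiffAt (e.open_target.mem_nhds hx)
  let V : TangentBundle IP P → TangentBundle IM M := fun w =>
    ⟨𝔓.proj w.proj, C.1 (𝔓.proj w.proj) (𝔓.Tproj w.proj w.snd)⟩
  have hV : ContMDiffAt IP.tangent IM.tangent ∞ V v :=
    ContMDiffAt.comp (I' := IM.tangent) v (C.2.contMDiffAt)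
      (𝔓.contMDiff_proj.contMDiff_tangentMap (m := ∞) (by simp)).contMDiffAt
  -- The derivative of the section with constant fibre coordinate through the base point of `w`.
  -- This section varies with `w`, hence the differential with parameters below.
  let L : ∀ w : TangentBundle IP P, TangentSpace IP w.proj := fun w =>
    (mfderiv IM IP (fun m => e.symm (m, (e w.proj).2)) (𝔓.proj w.proj) : EM →L[ℝ] EP) (V w).snd
  have hL : ContMDiffAt IP.tangent IP.tangent ∞
      (fun w : TangentBundle IP P => (⟨w.proj, L w⟩ : TangentBundle IP P)) v := by
    have h := ContMDiffAt.partial_tangentMap (I' := IP) (n := v)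
      (f := fun (w : TangentBundle IP P) m => e.symm (m, (e w.proj).2)) (V := V) ?_ hV
    · refine h.congr_of_eventuallyEq ?_
      filter_upwards [hnear] with w hw
      refine tangentBundle_mk_eq ?_ rfl
      change w.proj = e.symm (𝔓.proj w.proj, (e w.proj).2)
      rw [hfib hw, e.left_inv hw]
    · refine ContMDiffAt.comp (g := e.symm)
        (f := fun x : TangentBundle IP P × M => (x.2, (e x.1.proj).2)) (v, (V v).proj) (hsymm (hmt hv)) ?_
      refine contMDiffAt_snd.prodMk (contMDiffAt_snd.comp _ (ContMDiffAt.comp (g := e)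
        (f := fun x : TangentBundle IP P × M => x.1.proj) (v, (V v).proj)
        ((he _ hv).contMDiffAt (e.open_source.mem_nhds hv))
        (hpr.contMDiffAt.comp (v, (V v).proj) contMDiffAt_fst)))
  have hTL : ∀ᶠ w in nhds v, 𝔓.Tproj w.proj (L w) = C.1 (𝔓.proj w.proj) (𝔓.Tproj w.proj w.snd) := by
    filter_upwards [hnear] with w hw
    have hd : MDifferentiableAt IM IP (fun m => e.symm (m, (e w.proj).2)) (𝔓.proj w.proj) :=
      (ContMDiffAt.comp (g := e.symm) (f := fun m => (m, (e w.proj).2)) _ (hsymm (hmt hw))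
        (contMDiffAt_id.prodMk contMDiffAt_const)).mdifferentiableAt (by simp)
    have h := mfderiv_apply_of_leftInverse hd (𝔓.mdiff_proj _) (by
      have hwU : 𝔓.proj w.proj ∈ U := by rw [hs] at hw; exact hw
      filter_upwards [hU.mem_nhds hwU] with m hm
      have hmt : (m, (e w.proj).2) ∈ e.target := by rw [ht]; exact ⟨hm, mem_univ _⟩
      rw [Function.comp_apply, ← he1 _ (e.map_target hmt), e.right_inv hmt]
      rfl) (V w).snd
    refine Eq.trans ?_ h
    refine tangent_apply_congr ?_ (fun p => (mfderiv IP IM 𝔓.proj p : EP →L[ℝ] EM)) _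
    rw [hfib hw, e.left_inv hw]
  have hα : ContMDiffAt (M' := EG) IP.tangent 𝓘(ℝ, EG) ∞ (fun w : TangentBundle IP P =>
      (α.form w.proj w.snd - α.form w.proj (L w) : EG)) v :=
    α.smooth.contMDiffAt.sub (ContMDiffAt.comp (I' := IP.tangent) v α.smooth.contMDiffAt hL)
  refine (hL.tangent_add (𝔓.contMDiffAt_fund hpr.contMDiffAt hα)).congr_of_eventuallyEq ?_
  filter_upwards [hTL] with w hw
  refine congrArg (fun u => (⟨w.proj, u⟩ : TangentBundle IP P)) (α.ext_form_Tproj ?_ ?_)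
  · rw [form_horizontalMap, map_add, α.form_fund]
    exact (add_sub_cancel (G := EG) _ _).symm
  · rw [Tproj_horizontalMap, map_add, 𝔓.Tproj_fund, add_zero, hw]

variable [FiniteDimensional ℝ EP]

/-- `Π^v_α + Γ_α ∘ C ∘ Tμ` as a family of linear isomorphisms. -/
noncomputable def horizontalEquiv (C : TangentAut IM M) (p : P) : TangentSpace IP p ≃L[ℝ] TangentSpace IP p :=
  LinearEquiv.toContinuousLinearEquiv (E := EP) (F := EP) (𝕜 := ℝ)
    (LinearEquiv.ofLinearMap (α.horizontalMap C p) (α.horizontalMap C⁻¹ p)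
      (LinearMap.ext (α.horizontalMap_apply_inv C p)) (LinearMap.ext fun v => by
        have h := α.horizontalMap_apply_inv C⁻¹ p v
        rwa [inv_inv] at h))

/-- The homomorphism `σ_α : Aut₀ TM → Aut_{TG} TP` of a connection `α`. -/
noncomputable def autLift : TangentAut IM M →* 𝔓.AutTG :=
  MonoidHom.mk' (fun C => ⟨α.horizontalEquiv C,
    mem_AutTG (α.horizontalMap_smooth C) (α.horizontalMap_Tact C) (α.horizontalMap_fund C)⟩)
    fun C D => AutTG_ext (α.horizontalMap_mul C D)

theorem autLift_apply (C : TangentAut IM M) (p : P) (v : TangentSpace IP p) :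
    (α.autLift C).1 p v = α.verticalProj p v + α.lift p (C.1 (𝔓.proj p) (𝔓.Tproj p v)) := rfl

theorem autProj_autLift (C : TangentAut IM M) : 𝔓.autProj (α.autLift C) = C :=
  (autProj_eq_iff _ _).2 fun p v => (α.Tproj_horizontalMap C p v).symm

/-- In `σ_α(C) (id + B) σ_α(C)⁻¹` the outer factor fixes the vertical values of `B`, while `B` kills
the vertical part of `σ_α(C⁻¹) v` and sees only its horizontal part. -/
theorem apply_of_conj {C : TangentAut IM M} {B D : Multiplicative 𝔓.EndN}
    (h : (𝔓.EndNEquiv D : 𝔓.AutTG) = α.autLift C * 𝔓.EndNEquiv B * (α.autLift C)⁻¹)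
    (p : P) (v : TangentSpace IP p) :
    D.toAdd.1 p v = B.toAdd.1 p (α.lift p ((C⁻¹).1 (𝔓.proj p) (𝔓.Tproj p v))) := by
  rw [← map_inv] at h
  have h1 : v + D.toAdd.1 p v = α.horizontalMap C p
      (α.horizontalMap C⁻¹ p v + B.toAdd.1 p (α.horizontalMap C⁻¹ p v)) :=
    congrArg (fun A : 𝔓.AutTG => A.1 p v) h
  obtain ⟨X, hX⟩ := 𝔓.vert_le_range_fund p _ (EndN_Tproj B.toAdd p (α.horizontalMap C⁻¹ p v))
  rw [map_add, horizontalMap_apply_inv, ← hX, horizontalMap_fund, hX,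
    add_right_inj] at h1
  rw [h1, horizontalMap_apply, map_add, EndN_apply_vert B.toAdd p
    (v := α.verticalProj p v) (𝔓.Tproj_fund p _), zero_add]

end Horizontal
end Connection

end PrincipalBundle
end Principal

/-! ### The conjugation action and the semidirect product -/

/-- The inverse of `ν : N ≃* K` followed by the inclusion of a normal subgroup `K` turns conjugation
into an action on `N`. -/
noncomputable def conjAction {Γ N : Type*} [Group Γ] [Group N] {K : Subgroup Γ} [K.Normal]
    (ν : N ≃* K) : Γ →* MulAut N :=
  (MulAut.congr ν.symm).toMonoidHom.comp MulAut.conjNormal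

theorem conjAction_apply {Γ N : Type*} [Group Γ] [Group N] {K : Subgroup Γ} [K.Normal]
    (ν : N ≃* K) (g : Γ) (n : N) : (ν (conjAction ν g n) : Γ) = g * ν n * g⁻¹ := by
  change ((ν (ν.symm (MulAut.conjNormal g (ν n))) : K) : Γ) = _
  rw [ν.apply_symm_apply, MulAut.conjNormal_apply]

theorem proposition2
    {EM HM EG HG EP HP : Type*}
    [NormedAddCommGroup EM] [NormedSpace ℝ EM] [FiniteDimensional ℝ EM] [TopologicalSpace HM]
    [NormedAddCommGroup EG] [NormedSpace ℝ EG] [FiniteDimensional ℝ EG] [TopologicalSpace HG]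
    [NormedAddCommGroup EP] [NormedSpace ℝ EP] [FiniteDimensional ℝ EP] [TopologicalSpace HP]
    {IM : ModelWithCorners ℝ EM HM} [IM.Boundaryless]
    {IG : ModelWithCorners ℝ EG HG} [IG.Boundaryless]
    {IP : ModelWithCorners ℝ EP HP} [IP.Boundaryless]
    {M G P : Type*}
    [TopologicalSpace M] [ChartedSpace HM M] [IsManifold IM ∞ M]
    [T2Space M] [SecondCountableTopology M]
    [TopologicalSpace G] [ChartedSpace HG G] [Group G] [LieGroup IG ∞ G]
    [TopologicalSpace P] [ChartedSpace HP P] [IsManifold IP ∞ P]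
    (𝔓 : PrincipalBundle IM IG IP M G P) :
    -- the group `Aut_N TP` is the additive group `End_N TP` through `B ↦ id + B`
    ∃ ν : Multiplicative 𝔓.EndN ≃* 𝔓.AutN,
      (∀ (B : 𝔓.EndN) (p : P) (v : TangentSpace IP p),
        (ν (Multiplicative.ofAdd B)).1.1 p v = v + B.1 p v) ∧
      -- (i) `λ` and the short exact sequence
      ∃ lam : 𝔓.AutTG →* TangentAut IM M,
        (∀ (A : 𝔓.AutTG) (p : P) (v : TangentSpace IP p),
          (lam A).1 (𝔓.proj p) (𝔓.Tproj p v) = 𝔓.Tproj p (A.1 p v)) ∧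
        (∀ l : 𝔓.AutTG → TangentAut IM M,
          (∀ (A : 𝔓.AutTG) (p : P) (v : TangentSpace IP p),
            (l A).1 (𝔓.proj p) (𝔓.Tproj p v) = 𝔓.Tproj p (A.1 p v)) → l = lam) ∧
        Function.Injective 𝔓.AutN.subtype ∧
        𝔓.AutN.subtype.range = lam.ker ∧
        Function.Surjective lam ∧
        -- (ii) the maps `σ_α` and `β_α` of a connection `α`
        ∀ α : 𝔓.Connection,
          ∃ (σ : TangentAut IM M →* 𝔓.AutTG) (β : 𝔓.AutTG → 𝔓.AutN),
            (∀ (C : TangentAut IM M) (p : P) (v : TangentSpace IP p),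
              (σ C).1 p v = α.verticalProj p v + α.lift p (C.1 (𝔓.proj p) (𝔓.Tproj p v))) ∧
            (∀ A : 𝔓.AutTG, (β A : 𝔓.AutTG) = A * (σ (lam A))⁻¹) ∧
            Function.Injective σ ∧
            Function.Surjective β ∧
            (∀ A : 𝔓.AutTG, β A = 1 ↔ A ∈ σ.range) ∧
            (∀ C : TangentAut IM M, lam (σ C) = C) ∧
            (∀ N : 𝔓.AutN, β (N : 𝔓.AutTG) = N) ∧
            (∀ A₁ A₂ : 𝔓.AutTG, (β (A₁ * A₂) : 𝔓.AutTG) =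
              β A₁ * σ (lam A₁) * β A₂ * (σ (lam A₁))⁻¹) ∧
            -- (iii) the semidirect product, its product formula, and the decomposition
            ∃ (φ : TangentAut IM M →* MulAut (Multiplicative 𝔓.EndN))
              (Ψ : (Multiplicative 𝔓.EndN ⋊[φ] TangentAut IM M) ≃* 𝔓.AutTG),
              (∀ x y : Multiplicative 𝔓.EndN ⋊[φ] TangentAut IM M,
                (x * y).right = x.right * y.right ∧
                ∀ (p : P) (v : TangentSpace IP p),
                  (Multiplicative.toAdd (x * y).left).1 p v =
                    (Multiplicative.toAdd x.left).1 p v +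
                    (Multiplicative.toAdd y.left).1 p
                      (α.lift p ((x.right⁻¹).1 (𝔓.proj p) (𝔓.Tproj p v)))) ∧
              (∀ x : Multiplicative 𝔓.EndN ⋊[φ] TangentAut IM M,
                Ψ x = (ν x.left : 𝔓.AutTG) * σ x.right) := by
  -- The sequence in (i) mentions no connection; one is needed to lift elements of `Aut₀ TM`.
  obtain ⟨α₀⟩ := 𝔓.nonempty_connection
  have hker : ∀ A : 𝔓.AutTG, A ∈ 𝔓.AutN ↔ 𝔓.autProj A = 1 := fun A => by
    rw [← PrincipalBundle.autProj_ker, MonoidHom.mem_ker]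
  refine ⟨𝔓.EndNEquiv, fun B p v => rfl, 𝔓.autProj, PrincipalBundle.autProj_Tproj, fun l hl => ?_,
    Subtype.val_injective, by rw [Subgroup.range_subtype, PrincipalBundle.autProj_ker],
    fun C => ⟨α₀.autLift C, α₀.autProj_autLift C⟩, fun α => ?_⟩
  · exact funext fun A => ((PrincipalBundle.autProj_eq_iff A (l A)).2 (hl A)).symm
  let β : 𝔓.AutTG → 𝔓.AutN := fun A => ⟨A * (α.autLift (𝔓.autProj A))⁻¹, by
    rw [hker, map_mul, map_inv, α.autProj_autLift, mul_inv_cancel]⟩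
  have hβN : ∀ N : 𝔓.AutN, β (N : 𝔓.AutTG) = N := fun N => Subtype.ext (by
    change (N : 𝔓.AutTG) * (α.autLift (𝔓.autProj N))⁻¹ = N
    rw [(hker N).1 N.2, map_one, inv_one, mul_one])
  have : 𝔓.AutN.Normal := by
    rw [← PrincipalBundle.autProj_ker]; infer_instance
  let φ := (conjAction 𝔓.EndNEquiv).comp α.autLift
  have hφ : ∀ C B, (𝔓.EndNEquiv (φ C B) : 𝔓.AutTG) =
      α.autLift C * 𝔓.EndNEquiv B * (α.autLift C)⁻¹ := fun C => conjAction_apply 𝔓.EndNEquiv (α.autLift C)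
  let Ψ : Multiplicative 𝔓.EndN ⋊[φ] TangentAut IM M →* 𝔓.AutTG :=
    SemidirectProduct.lift (𝔓.AutN.subtype.comp 𝔓.EndNEquiv.toMonoidHom) α.autLift
      fun C => MonoidHom.ext fun B => hφ C B
  have hΨ : ∀ x, Ψ x = (𝔓.EndNEquiv x.left : 𝔓.AutTG) * α.autLift x.right := fun x => rfl
  -- `λ` recovers the second component, and cancelling `σ_α` then recovers the first; this is
  -- injectivity of `Ψ`.
  have hΨproj : ∀ x, 𝔓.autProj (Ψ x) = x.right := fun x => by
    rw [hΨ, map_mul, (hker _).1 (𝔓.EndNEquiv x.left).2, one_mul, α.autProj_autLift]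
  have hbij : Function.Bijective Ψ := by
    constructor
    · intro x y h
      have hr : x.right = y.right := by rw [← hΨproj x, h, hΨproj y]
      rw [hΨ, hΨ, hr, mul_left_inj] at h
      exact SemidirectProduct.ext (𝔓.EndNEquiv.injective (Subtype.ext h)) hr
    · intro A
      refine ⟨⟨𝔓.EndNEquiv.symm (β A), 𝔓.autProj A⟩, ?_⟩
      rw [hΨ, MulEquiv.apply_symm_apply]
      -- The decomposition `A = β_α(A) σ_α(λ(A))`.
      exact inv_mul_cancel_right _ _
  refine ⟨α.autLift, β, α.autLift_apply, fun A => rfl,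
    Function.LeftInverse.injective α.autProj_autLift, fun N => ⟨N, hβN N⟩, fun A => ?_,
    α.autProj_autLift, hβN, fun A₁ A₂ => ?_, φ, MulEquiv.ofBijective Ψ hbij,
    fun x y => ⟨rfl, fun p v => ?_⟩, hΨ⟩
  · rw [← Subtype.coe_inj]
    change A * (α.autLift (𝔓.autProj A))⁻¹ = 1 ↔ _
    rw [mul_inv_eq_one]
    refine ⟨fun h => ⟨_, h.symm⟩, ?_⟩
    rintro ⟨C, rfl⟩
    rw [α.autProj_autLift]
  · change A₁ * A₂ * (α.autLift (𝔓.autProj (A₁ * A₂)))⁻¹ = A₁ * (α.autLift (𝔓.autProj A₁))⁻¹ *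
      α.autLift (𝔓.autProj A₁) * (A₂ * (α.autLift (𝔓.autProj A₂))⁻¹) * (α.autLift (𝔓.autProj A₁))⁻¹
    rw [map_mul, map_mul]
    group
  · rw [SemidirectProduct.mul_left]
    change x.left.toAdd.1 p v + (φ x.right y.left).toAdd.1 p v = _
    congr 1
    exact α.apply_of_conj (hφ x.right y.left) p v
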